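/- **Progress for LinksT.** Let $M$ be a LinksT term, $\Gamma$ a context and $A$ a type with $\Gamma\vdash M:A$. Then $M$ is in LinksT normal form, or there is a LinksT term $M'$ with $M\leadsto M'$. The calculus LinksT is as follows; expressions are taken up to renaming of bound variables, and bound variables are chosen fresh. **Syntax.** Here $c$ ranges over Boolean, integer and string literals, and rows are lists of labelled components (there is no rule for reordering them). - Kinds $K ::= \mathit{Type}\mid\mathit{BaseType}\mid\mathit{Row}\mid\mathit{BaseRow}\mid K_1\to K_2$. - Constructors $C,D ::= \mathtt{Bool}^*\mid\mathtt{Int}^*\mid\mathtt{String}^*\mid\alpha\mid\lambda\alpha{:}K.C\mid C\,D\mid C\,S\mid\mathtt{List}^*\,C\mid\mathtt{Record}^*\,S\mid\mathtt{Trace}^*\,C\mid\mathsf{Typerec}\,C\,(C_B,C_I,C_S,C_L,C_R,C_T)$. - Row constructors $S ::= \cdot\mid l:C;S\mid\rho\mid\mathsf{Rmap}\,C\,S$. Row variables $\rho$ are exactly the type-level variables of kind $\mathit{Row}$ or $\mathit{BaseRow}$; all others are type variables $\alpha$. - Types $A,B ::= \mathtt T(C)\mid\mathtt{Bool}\mid\mathtt{Int}\mid\mathtt{String}\mid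 A\to B\mid\mathtt{List}\,A\mid\mathtt{Record}\,R\mid\mathtt{Trace}\,A\mid\forall\alpha{:}K.A$; row types $R ::= \cdot\mid l:A;R\mid\mathtt T(S)$. We write $\langle R\rangle$ for $\mathtt{Record}\,R$, also in $\mathsf{table}\,n\,\langle R\rangle$. - Terms $L,M,N ::= c\mid x\mid\lambda x{:}A.M\mid M\,N\mid\Lambda\alpha{:}K.M\mid M\,C\mid M\,S\mid\mathsf{fix}\,f{:}A.M\mid\mathsf{if}\,L\,\mathsf{then}\,M\,\mathsf{else}\,N\mid M+N\mid M==N\mid\langle\rangle\mid\langle l=M;N\rangle\mid M.l\mid\mathsf{rmap}^S\,M\,N\mid\mathsf{rfold}^S\,L\,M\,N\mid[]\mid[M]\mid M\mathbin{+\!\!+}N\mid\mathsf{for}\,(x\leftarrow M)\,N\mid\mathsf{table}\,n\,\langle R\rangle\mid\mathtt{Lit}\,M\mid\mathtt{If}\,M\mid\mathtt{For}\,C\,M\mid\mathtt{Cell}\,M\mid\mathtt{OpEq}\,C\,M\mid\mathtt{OpPlus}\,M\mid\mathsf{tracecase}\,M\,\mathsf{of}\,(x.M_L,x.M_I,\alpha.x.M_F,x.M_C,\alpha.x.M_E,x.M_P)\mid\mathsf{typecase}\,C\,\mathsf{of}\,(M_B,M_I,M_S,\beta.M_L,\rho.M_R,\gamma.M_T)$.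 Here $\Lambda\alpha{:}K$, $\lambda\alpha{:}K$ and $\forall\alpha{:}K$ bind a row variable if $K\in\{\mathit{Row},\mathit{BaseRow}\}$. A context $\Gamma$ assigns kinds to type and row variables and types to term variables; it is well formed if every type in it has kind $\mathit{Type}$. **Kinding.** Subkinding is the structural (contravariant/covariant on arrows) relation generated by $\mathit{BaseType}\le\mathit{Type}$ and $\mathit{BaseRow}\le\mathit{Row}$; all kinding and equivalence judgements of constructors and types are closed under it. Constructors: $\mathtt{Bool}^*,\mathtt{Int}^*,\mathtt{String}^*:\mathit{BaseType}$; variables have their kind in $\Gamma$; $\lambda\alpha{:}K_1.C:K_1\to K_2$ if $\Gamma,\alpha{:}K_1\vdash C:K_2$; an application of $C:K_1\to K_2$ to an argument of kind $K_1$ has kind $K_2$, the argument being a row constructor if $K_1\in\{\mathit{Row},\mathit{BaseRow}\}$ and a constructor otherwise; $\mathtt{List}^*C:\mathit{Type}$ if $C:\mathit{Type}$; $\mathtt{Record}^*S:\mathit{Type}$ if $S:\mathit{Row}$; $\mathtt{Trace}^*C:\mathit{Type}$ if $C:\mathit{BaseType}$; $\mathsf{Typerec}\,C\,(C_B,\dots,C_T):K$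 if $C:\mathit{Type}$, $C_B,C_I,C_S:K$, $C_L:\mathit{Type}\to K\to K$, $C_R:\mathit{Row}\to\mathit{Row}\to K$, $C_T:\mathit{BaseType}\to K\to K$; $\cdot:\mathit{Row}$ and $\cdot:\mathit{BaseRow}$; $l{:}C;S$ has kind $\mathit{Row}$ if $C:\mathit{Type}$, $S:\mathit{Row}$, and kind $\mathit{BaseRow}$ if $C:\mathit{BaseType}$, $S:\mathit{BaseRow}$; $\mathsf{Rmap}\,C\,S:\mathit{Row}$ if $C:\mathit{Type}\to\mathit{Type}$, $S:\mathit{Row}$. Types: $\mathtt T(C)$ has kind $\mathit{Type}$ (resp. $\mathit{BaseType}$) if $C$ has, $\mathtt T(S)$ has kind $\mathit{Row}$ (resp. $\mathit{BaseRow}$) if $S$ has; $\mathtt{Bool},\mathtt{Int},\mathtt{String}:\mathit{BaseType}$; $A\to B$, $\mathtt{List}\,A$, $\forall\alpha{:}K.A$ have kind $\mathit{Type}$ if $A,B$ do (in $\Gamma,\alpha{:}K$ for $\forall$); $\mathtt{Record}\,R:\mathit{Type}$ if $R:\mathit{Row}$; $\mathtt{Trace}\,A:\mathit{Type}$ if $A:\mathit{BaseType}$;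 $\cdot$ and $l{:}A;R$ as for row constructors. **Constructor reduction** $\leadsto$ is the closure under all constructor and row constructor contexts of: $(\lambda\alpha{:}K.C)\,D\leadsto C[\alpha:=D]$ (likewise for a row argument, when $K$ is $\mathit{Row}$ or $\mathit{BaseRow}$); $\mathsf{Rmap}\,C\,\cdot\leadsto\cdot$; $\mathsf{Rmap}\,C\,(l{:}D;S)\leadsto(l{:}C\,D;\mathsf{Rmap}\,C\,S)$; and, writing $\vec C=(C_B,C_I,C_S,C_L,C_R,C_T)$, $\mathsf{Typerec}\,\mathtt{Bool}^*\,\vec C\leadsto C_B$, $\mathsf{Typerec}\,\mathtt{Int}^*\,\vec C\leadsto C_I$, $\mathsf{Typerec}\,\mathtt{String}^*\,\vec C\leadsto C_S$, $\mathsf{Typerec}\,(\mathtt{List}^*D)\,\vec C\leadsto C_L\,D\,(\mathsf{Typerec}\,D\,\vec C)$, $\mathsf{Typerec}\,(\mathtt{Record}^*S)\,\vec C\leadsto C_R\,S\,(\mathsf{Rmap}\,(\lambda\alpha{:}\mathit{Type}.\mathsf{Typerec}\,\alpha\,\vec C)\,S)$, $\mathsf{Typerec}\,(\mathtt{Trace}^*D)\,\vec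 C\leadsto C_T\,D\,(\mathsf{Typerec}\,D\,\vec C)$. **Equivalence.** $\Gamma\vdash C=D:K$ is the kinded congruent equivalence relation on constructors and row constructors that contains $C=D:K$ whenever $C\leadsto D$ and both have kind $K$, and $\lambda\alpha{:}K.C\,\alpha=C:K\to K'$ for $C:K\to K'$. $\Gamma\vdash A=B:K$ is the kinded congruent equivalence relation on types and row types that contains $\mathtt T(C)=\mathtt T(D)$ for $C=D$ at kind $\mathit{Type}$ or $\mathit{BaseType}$, $\mathtt T(S)=\mathtt T(S')$ for $S=S'$ at kind $\mathit{Row}$ or $\mathit{BaseRow}$, $\mathtt T(\mathtt{Bool}^*)=\mathtt{Bool}$, $\mathtt T(\mathtt{Int}^*)=\mathtt{Int}$, $\mathtt T(\mathtt{String}^*)=\mathtt{String}$, $\mathtt T(\mathtt{List}^*C)=\mathtt{List}\,\mathtt T(C)$, $\mathtt T(\mathtt{Record}^*S)=\mathtt{Record}\,\mathtt T(S)$, $\mathtt T(\mathtt{Trace}^*C)=\mathtt{Trace}\,\mathtt T(C)$, $\mathtt T(\cdot)=\cdot$, $\mathtt T(l{:}C;S)=(l{:}\mathtt T(C);\mathtt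 T(S))$, for well-kinded arguments. **Typing** $\Gamma\vdash M:A$. Let $\mathtt{TRACE}=\lambda\alpha{:}\mathit{Type}.\mathsf{Typerec}\,\alpha\,(\mathtt{Trace}^*\mathtt{Bool}^*,\mathtt{Trace}^*\mathtt{Int}^*,\mathtt{Trace}^*\mathtt{String}^*,\lambda\_{:}\mathit{Type}.\lambda\beta{:}\mathit{Type}.\mathtt{List}^*\beta,\lambda\_{:}\mathit{Row}.\lambda\rho{:}\mathit{Row}.\mathtt{Record}^*\rho,\lambda\_{:}\mathit{BaseType}.\lambda\beta{:}\mathit{Type}.\beta)$. The rules are: literals have type $\mathtt{Bool}$, $\mathtt{Int}$ or $\mathtt{String}$; variables have their type in $\Gamma$; $\lambda x{:}A.M:A\to B$ if $A:\mathit{Type}$ and $\Gamma,x{:}A\vdash M:B$; $M\,N:B$ if $M:A\to B$, $N:A$; $\Lambda\alpha{:}K.M:\forall\alpha{:}K.A$ if $\Gamma,\alpha{:}K\vdash M:A$; $M\,C:A[\alpha:=C]$ if $M:\forall\alpha{:}K.A$ and $C:K$ (with a row constructor $S$ for $C$ if $K$ is $\mathit{Row}$ or $\mathit{BaseRow}$);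 $\mathsf{fix}\,f{:}A.M:A$ if $A:\mathit{Type}$ and $\Gamma,f{:}A\vdash M:A$; $\mathsf{if}\,L\,\mathsf{then}\,M\,\mathsf{else}\,N:A$ if $L:\mathtt{Bool}$, $M:A$, $N:A$; $M+N:\mathtt{Int}$ if $M,N:\mathtt{Int}$; $M==N:\mathtt{Bool}$ if $M,N:A$ and $A:\mathit{BaseType}$; $\mathsf{table}\,n\,\langle\mathsf{oid}{:}\mathtt{Int};R\rangle:\mathtt{List}\langle\mathsf{oid}{:}\mathtt{Int};R\rangle$ if $\cdot\vdash R:\mathit{BaseRow}$; $[]:\mathtt{List}\,A$ if $A:\mathit{Type}$; $[M]:\mathtt{List}\,A$ if $M:A$; $M\mathbin{+\!\!+}N:\mathtt{List}\,A$ if $M,N:\mathtt{List}\,A$; $\mathsf{for}\,(x\leftarrow M)\,N:\mathtt{List}\,B$ if $M:\mathtt{List}\,A$ and $\Gamma,x{:}A\vdash N:\mathtt{List}\,B$; $\langle\rangle:\langle\cdot\rangle$ if $\Gamma$ is well formed; $\langle l=M;N\rangle:\langle l{:}A;R\rangle$ if $M:A$, $N:\langle R\rangle$; $M.l:A$ if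 $M:\langle l{:}A;R\rangle$; $M:A$ if $M:B$ and $\Gamma\vdash A=B:\mathit{Type}$; $\mathsf{rmap}^S\,M\,N:\mathtt T(\mathtt{Record}^*(\mathsf{Rmap}\,C\,S))$ if $S:\mathit{Row}$, $M:\forall\alpha{:}\mathit{Type}.\mathtt T(\alpha)\to\mathtt T(C\,\alpha)$, $N:\mathtt T(\mathtt{Record}^*S)$; $\mathsf{rfold}^S\,L\,M\,N:\mathtt T(C)$ if $S:\mathit{Row}$, $L:\mathtt T(C)\to\mathtt T(C)\to\mathtt T(C)$, $M:\mathtt T(C)$, $N:\mathtt T(\mathtt{Record}^*(\mathsf{Rmap}\,(\lambda\alpha{:}\mathit{Type}.C)\,S))$, $\alpha$ not free in $C$; $\mathsf{typecase}\,C\,\mathsf{of}\,(M_B,M_I,M_S,\beta.M_L,\rho.M_R,\gamma.M_T):B[\alpha:=C]$ if $C:\mathit{Type}$, $\Gamma,\alpha{:}\mathit{Type}\vdash B:\mathit{Type}$, $\Gamma\vdash M_B:B[\alpha:=\mathtt{Bool}^*]$, $\Gamma\vdash M_I:B[\alpha:=\mathtt{Int}^*]$, $\Gamma\vdash M_S:B[\alpha:=\mathtt{String}^*]$,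 $\Gamma,\beta{:}\mathit{Type}\vdash M_L:B[\alpha:=\mathtt{List}^*\beta]$, $\Gamma,\rho{:}\mathit{Row}\vdash M_R:B[\alpha:=\mathtt{Record}^*\rho]$, $\Gamma,\gamma{:}\mathit{BaseType}\vdash M_T:B[\alpha:=\mathtt{Trace}^*\gamma]$. For traces put $I_A=\langle\mathsf{cond}{:}\mathtt{Trace\,Bool};\mathsf{out}{:}\mathtt{Trace}\,A\rangle$, $F_{C,A}=\langle\mathsf{in}{:}\mathtt T(\mathtt{TRACE}\,C);\mathsf{out}{:}\mathtt{Trace}\,A\rangle$, $L_A=\langle\mathsf{table}{:}\mathtt{String};\mathsf{column}{:}\mathtt{String};\mathsf{row}{:}\mathtt{Int};\mathsf{data}{:}A\rangle$, $O_A=\langle\mathsf{left}{:}A;\mathsf{right}{:}A\rangle$. Then $\mathtt{Lit}\,M:\mathtt{Trace}\,A$ if $M:A$ and $A$ is $\mathtt{Bool}$, $\mathtt{Int}$ or $\mathtt{String}$; $\mathtt{If}\,M:\mathtt{Trace}\,A$ if $M:I_A$; $\mathtt{For}\,C\,M:\mathtt{Trace}\,A$ if $C:\mathit{Type}$, $M:F_{C,A}$;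 $\mathtt{Cell}\,M:\mathtt{Trace}\,A$ if $M:L_A$; $\mathtt{OpEq}\,C\,M:\mathtt{Trace\,Bool}$ if $C:\mathit{BaseType}$, $M:O_{\mathtt T(\mathtt{TRACE}\,C)}$; $\mathtt{OpPlus}\,M:\mathtt{Trace\,Int}$ if $M:O_{\mathtt{Trace\,Int}}$; $\mathsf{tracecase}\,M\,\mathsf{of}\,(x.M_L,x.M_I,\alpha.x.M_F,x.M_C,\alpha.x.M_E,x.M_P):B$ if $M:\mathtt{Trace}\,A$ and $M_L$, $M_I$, $M_F$, $M_C$, $M_E$, $M_P$ have type $B$ in $\Gamma$ extended by, respectively, $x{:}A$; $x{:}I_A$; $\alpha{:}\mathit{Type},x{:}F_{\alpha,A}$; $x{:}L_A$; $\alpha{:}\mathit{BaseType},x{:}O_{\mathtt T(\mathtt{TRACE}\,\alpha)}$; $x{:}O_{\mathtt{Trace\,Int}}$. **Term reduction** $\leadsto$ is the least relation that contains the rules (1) and (2) below and is closed under reduction of any immediate subterm (also under binders and in branches), except the body of a $\mathsf{fix}$, and under constructor reduction of the constructor or row constructor immediately inside $M\,C$, $M\,S$, $\mathsf{rmap}^S$,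 $\mathsf{rfold}^S$, $\mathtt{For}\,C\,M$, $\mathtt{OpEq}\,C\,M$ and $\mathsf{typecase}\,C$. (1) $\beta$-rules: $(\lambda x{:}A.M)\,N\leadsto M[x:=N]$; $\mathsf{fix}\,f{:}A.M\leadsto M[f:=\mathsf{fix}\,f{:}A.M]$; $(\Lambda\alpha{:}K.M)\,C\leadsto M[\alpha:=C]$ (likewise for row constructors); $\mathsf{if}\,\mathsf{true}\,\mathsf{then}\,M\,\mathsf{else}\,N\leadsto M$; $\mathsf{if}\,\mathsf{false}\,\mathsf{then}\,M\,\mathsf{else}\,N\leadsto N$; $\langle l_1=M_1;\dots;l_n=M_n;N\rangle.l_i\leadsto M_i$ if $l_j\ne l_i$ for $j<i$ ($N$ arbitrary); $\mathsf{rmap}^{(l_1:C_1;\dots;l_n:C_n;\cdot)}\,M\,N\leadsto\langle l_1=(M\,C_1)\,N.l_1;\dots;l_n=(M\,C_n)\,N.l_n\rangle$; $\mathsf{rfold}^{(l_1:C_1;\dots;l_n:C_n;\cdot)}\,L\,M\,N\leadsto L\,N.l_1\,(L\,N.l_2\cdots(L\,N.l_n\,M)\cdots)$; $\mathsf{for}\,(x\leftarrow[])\,N\leadsto[]$;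 $\mathsf{for}\,(x\leftarrow[M])\,N\leadsto N[x:=M]$; $\mathsf{tracecase}$ applied to $\mathtt{Lit}\,M$, $\mathtt{If}\,M$, $\mathtt{For}\,C\,M$, $\mathtt{Cell}\,M$, $\mathtt{OpEq}\,C\,M$, $\mathtt{OpPlus}\,M$ reduces to $M_L[x:=M]$, $M_I[x:=M]$, $M_F[\alpha:=C,x:=M]$, $M_C[x:=M]$, $M_E[\alpha:=C,x:=M]$, $M_P[x:=M]$; $\mathsf{typecase}$ applied to $\mathtt{Bool}^*$, $\mathtt{Int}^*$, $\mathtt{String}^*$, $\mathtt{List}^*C$, $\mathtt{Record}^*S$, $\mathtt{Trace}^*C$ reduces to $M_B$, $M_I$, $M_S$, $M_L[\beta:=C]$, $M_R[\rho:=S]$, $M_T[\gamma:=C]$. (2) Commuting conversions: $E[\mathsf{if}\,L\,\mathsf{then}\,M_1\,\mathsf{else}\,M_2]\leadsto\mathsf{if}\,L\,\mathsf{then}\,E[M_1]\,\mathsf{else}\,E[M_2]$ for $E$ one of $\square\,N$, $\square\,C$, $\square\,S$, $\square.l$, $\mathsf{if}\,\square\,\mathsf{then}\,N_1\,\mathsf{else}\,N_2$,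 $\mathsf{for}\,(x\leftarrow\square)\,N$, $\mathsf{tracecase}\,\square\,\mathsf{of}\,(\dots)$; $\mathsf{for}\,(x\leftarrow M_1\mathbin{+\!\!+}M_2)\,N\leadsto(\mathsf{for}\,(x\leftarrow M_1)\,N)\mathbin{+\!\!+}(\mathsf{for}\,(x\leftarrow M_2)\,N)$; $\mathsf{for}\,(x\leftarrow\mathsf{for}\,(y\leftarrow L)\,M)\,N\leadsto\mathsf{for}\,(y\leftarrow L)\,\mathsf{for}\,(x\leftarrow M)\,N$. **LinksT normal form.** $M$ is in LinksT normal form if it is generated by the nonterminal for normal terms in the following grammar (in which $C,D$, $S$, $L,M,N$ and all branches stand for normal constructors, row constructors and terms, while types $A$ and row types $R$ are arbitrary): - Normal constructors $C,D ::= E\mid\mathtt{Bool}^*\mid\mathtt{Int}^*\mid\mathtt{String}^*\mid\lambda\alpha{:}K.C\mid\mathtt{List}^*C\mid\mathtt{Record}^*S\mid\mathtt{Trace}^*C$ - Neutral constructors $E ::= \alpha\mid E\,C\mid E\,S\mid\mathsf{Typerec}\,E\,(C_B,C_I,C_S,C_L,C_R,C_T)$ - Normal row constructors $S ::= \cdot\mid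 l:C;S\mid U$ - Neutral row constructors $U ::= \rho\mid l:C;U\mid\mathsf{Rmap}\,C\,U$ - Normal terms $L,M,N ::= F\mid c\mid\lambda x{:}A.M\mid\Lambda\alpha{:}K.M\mid\mathsf{if}\,H\,\mathsf{then}\,M\,\mathsf{else}\,N\mid M+N\mid M==N\mid\langle\rangle\mid\langle l=M;N\rangle\mid\mathsf{rmap}^U\,M\,N\mid[]\mid[M]\mid M\mathbin{+\!\!+}N\mid\mathsf{for}\,(x\leftarrow T)\,N\mid\mathsf{table}\,n\,\langle R\rangle\mid\mathtt{Lit}\,M\mid\mathtt{If}\,M\mid\mathtt{For}\,C\,M\mid\mathtt{Cell}\,M\mid\mathtt{OpEq}\,C\,M\mid\mathtt{OpPlus}\,M$ - Neutral terms $F ::= x\mid P.l\mid F\,M\mid F\,C\mid F\,S\mid\mathsf{rfold}^U\,L\,M\,N\mid\mathsf{tracecase}\,F\,\mathsf{of}\,(x.M_L,x.M_I,\alpha.x.M_F,x.M_C,\alpha.x.M_E,x.M_P)\mid\mathsf{typecase}\,E\,\mathsf{of}\,(M_B,M_I,M_S,\beta.M_L,\rho.M_R,\gamma.M_T)$ -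 Neutral conditionals $H ::= F\mid M==N$; neutral projections $P ::= F\mid\mathsf{rmap}^U\,M\,N$; neutral tables $T ::= F\mid\mathsf{table}\,n\,\langle R\rangle$ -/

import Mathlib

/-! The calculus LinksT: syntax, kinding, equivalence, typing, reduction and normal forms.

Binding is represented by de Bruijn indices, so that terms are taken up to renaming of bound
variables.  Type and row variables are indexed separately from term variables; accordingly a
context is a pair of a list `Δ` of kinds and a list `Γ` of types over `Δ`.  Freshness side
conditions are then automatic. -/

namespace LinksT

/-- Record labels; the labels that the rules mention by name are listed separately. -/
inductive Label : Type
  | oid | cond | out | input | table | column | row | data | left | right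
  | name (s : String)
  deriving DecidableEq

/-- The two syntactic sorts: (type) constructors and types, row constructors and row types. -/
inductive Srt : Type
  | con | row
  deriving DecidableEq

inductive Kind : Type
  | type | baseType | row | baseRow
  | arr (K₁ K₂ : Kind)
  deriving DecidableEq

/-- The sort of the variables of a given kind: the variables of kind `Row` or `BaseRow` are the
row variables `ρ`. -/
def Kind.srt : Kind → Srt
  | .row => .row
  | .baseRow => .row
  | _ => .con

/-- Constructors `C`, `D` are the elements of `Con .con`, row constructors `S` those of
`Con .row`.  Type-level functions may be applied to either. -/
inductive Con : Srt → Type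
  | var (s : Srt) (n : ℕ) : Con s
  | bool : Con .con
  | int : Con .con
  | str : Con .con
  | lam (K : Kind) (C : Con .con) : Con .con
  | app {s : Srt} (C : Con .con) (D : Con s) : Con .con
  | list (C : Con .con) : Con .con
  | record (S : Con .row) : Con .con
  | trace (C : Con .con) : Con .con
  | typerec (C CB CI CS CL CR CT : Con .con) : Con .con
  | nil : Con .row
  | cons (l : Label) (C : Con .con) (S : Con .row) : Con .row
  | rmap (C : Con .con) (S : Con .row) : Con .row

/-- Types `A`, `B` are the elements of `Ty .con`, row types `R` those of `Ty .row`. -/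
inductive Ty : Srt → Type
  | T {s : Srt} (C : Con s) : Ty s
  | bool : Ty .con
  | int : Ty .con
  | str : Ty .con
  | fn (A B : Ty .con) : Ty .con
  | list (A : Ty .con) : Ty .con
  | record (R : Ty .row) : Ty .con
  | trace (A : Ty .con) : Ty .con
  | all (K : Kind) (A : Ty .con) : Ty .con
  | nil : Ty .row
  | cons (l : Label) (A : Ty .con) (R : Ty .row) : Ty .row

inductive Const : Type
  | bool (b : Bool)
  | int (i : ℤ)
  | str (s : String)

/-- Terms.  `lam`, `fix` and the body of `for` bind one term variable, `tlam` binds a type or row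
variable.  In `tracecase`, every branch binds a term variable, and `MF`, `ME` also bind a type
variable; in `typecase`, the branches `ML`, `MR`, `MT` bind a type or row variable. -/
inductive Tm : Type
  | const (c : Const)
  | var (n : ℕ)
  | lam (A : Ty .con) (M : Tm)
  | app (M N : Tm)
  | tlam (K : Kind) (M : Tm)
  | tapp {s : Srt} (M : Tm) (C : Con s)
  | fix (A : Ty .con) (M : Tm)
  | ite (L M N : Tm)
  | plus (M N : Tm)
  | eq (M N : Tm)
  | unit
  | ext (l : Label) (M N : Tm)
  | proj (M : Tm) (l : Label)
  | rmap (S : Con .row) (M N : Tm)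
  | rfold (S : Con .row) (L M N : Tm)
  | nil
  | single (M : Tm)
  | append (M N : Tm)
  | for (M N : Tm)
  | table (n : String) (R : Ty .row)
  | trLit (M : Tm)
  | trIf (M : Tm)
  | trFor (C : Con .con) (M : Tm)
  | trCell (M : Tm)
  | trOpEq (C : Con .con) (M : Tm)
  | trOpPlus (M : Tm)
  | tracecase (M ML MI MF MC ME MP : Tm)
  | typecase (C : Con .con) (MB MI MS ML MR MT : Tm)

/-! ### Renaming and substitution -/

def liftRen (ξ : ℕ → ℕ) : ℕ → ℕ
  | 0 => 0
  | n + 1 => ξ n + 1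

def Con.ren : {s : Srt} → (ℕ → ℕ) → Con s → Con s
  | _, ξ, .var s n => .var s (ξ n)
  | _, _, .bool => .bool
  | _, _, .int => .int
  | _, _, .str => .str
  | _, ξ, .lam K C => .lam K (C.ren (liftRen ξ))
  | _, ξ, .app C D => .app (C.ren ξ) (D.ren ξ)
  | _, ξ, .list C => .list (C.ren ξ)
  | _, ξ, .record S => .record (S.ren ξ)
  | _, ξ, .trace C => .trace (C.ren ξ)
  | _, ξ, .typerec C CB CI CS CL CR CT =>
      .typerec (C.ren ξ) (CB.ren ξ) (CI.ren ξ) (CS.ren ξ) (CL.ren ξ) (CR.ren ξ) (CT.ren ξ)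
  | _, _, .nil => .nil
  | _, ξ, .cons l C S => .cons l (C.ren ξ) (S.ren ξ)
  | _, ξ, .rmap C S => .rmap (C.ren ξ) (S.ren ξ)

/-- Weakening by one type or row variable. -/
abbrev Con.wk {s : Srt} (C : Con s) : Con s := C.ren Nat.succ

/-- Simultaneous substitutions for type and row variables. -/
abbrev TSub : Type := (s : Srt) → ℕ → Con s

def TSub.lift (σ : TSub) : TSub := fun s n =>
  match n with
  | 0 => .var s 0
  | n + 1 => (σ s n).wk

/-- The substitution `[α := D]` for the last bound variable.  A constructor replaces a type
variable and a row constructor replaces a row variable; an occurrence of index `0` at the other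
sort never arises in well-kinded expressions and is left alone. -/
def TSub.inst {s' : Srt} (D : Con s') : TSub := fun s n =>
  match n with
  | 0 => if h : s' = s then h ▸ D else .var s 0
  | n + 1 => .var s n

def Con.subst : {s : Srt} → TSub → Con s → Con s
  | _, σ, .var s n => σ s n
  | _, _, .bool => .bool
  | _, _, .int => .int
  | _, _, .str => .str
  | _, σ, .lam K C => .lam K (C.subst σ.lift)
  | _, σ, .app C D => .app (C.subst σ) (D.subst σ)
  | _, σ, .list C => .list (C.subst σ)
  | _, σ, .record S => .record (S.subst σ)
  | _, σ, .trace C => .trace (C.subst σ)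
  | _, σ, .typerec C CB CI CS CL CR CT =>
      .typerec (C.subst σ) (CB.subst σ) (CI.subst σ) (CS.subst σ) (CL.subst σ) (CR.subst σ)
        (CT.subst σ)
  | _, _, .nil => .nil
  | _, σ, .cons l C S => .cons l (C.subst σ) (S.subst σ)
  | _, σ, .rmap C S => .rmap (C.subst σ) (S.subst σ)

def Ty.ren : {s : Srt} → (ℕ → ℕ) → Ty s → Ty s
  | _, ξ, .T C => .T (C.ren ξ)
  | _, _, .bool => .bool
  | _, _, .int => .int
  | _, _, .str => .str
  | _, ξ, .fn A B => .fn (A.ren ξ) (B.ren ξ)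
  | _, ξ, .list A => .list (A.ren ξ)
  | _, ξ, .record R => .record (R.ren ξ)
  | _, ξ, .trace A => .trace (A.ren ξ)
  | _, ξ, .all K A => .all K (A.ren (liftRen ξ))
  | _, _, .nil => .nil
  | _, ξ, .cons l A R => .cons l (A.ren ξ) (R.ren ξ)

abbrev Ty.wk {s : Srt} (A : Ty s) : Ty s := A.ren Nat.succ

def Ty.subst : {s : Srt} → TSub → Ty s → Ty s
  | _, σ, .T C => .T (C.subst σ)
  | _, _, .bool => .bool
  | _, _, .int => .int
  | _, _, .str => .str
  | _, σ, .fn A B => .fn (A.subst σ) (B.subst σ)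
  | _, σ, .list A => .list (A.subst σ)
  | _, σ, .record R => .record (R.subst σ)
  | _, σ, .trace A => .trace (A.subst σ)
  | _, σ, .all K A => .all K (A.subst σ.lift)
  | _, _, .nil => .nil
  | _, σ, .cons l A R => .cons l (A.subst σ) (R.subst σ)

/-- Renaming of type and row variables in terms. -/
def Tm.tren : (ℕ → ℕ) → Tm → Tm
  | _, .const c => .const c
  | _, .var n => .var n
  | ξ, .lam A M => .lam (A.ren ξ) (M.tren ξ)
  | ξ, .app M N => .app (M.tren ξ) (N.tren ξ)
  | ξ, .tlam K M => .tlam K (M.tren (liftRen ξ))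
  | ξ, .tapp M C => .tapp (M.tren ξ) (C.ren ξ)
  | ξ, .fix A M => .fix (A.ren ξ) (M.tren ξ)
  | ξ, .ite L M N => .ite (L.tren ξ) (M.tren ξ) (N.tren ξ)
  | ξ, .plus M N => .plus (M.tren ξ) (N.tren ξ)
  | ξ, .eq M N => .eq (M.tren ξ) (N.tren ξ)
  | _, .unit => .unit
  | ξ, .ext l M N => .ext l (M.tren ξ) (N.tren ξ)
  | ξ, .proj M l => .proj (M.tren ξ) l
  | ξ, .rmap S M N => .rmap (S.ren ξ) (M.tren ξ) (N.tren ξ)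
  | ξ, .rfold S L M N => .rfold (S.ren ξ) (L.tren ξ) (M.tren ξ) (N.tren ξ)
  | _, .nil => .nil
  | ξ, .single M => .single (M.tren ξ)
  | ξ, .append M N => .append (M.tren ξ) (N.tren ξ)
  | ξ, .for M N => .for (M.tren ξ) (N.tren ξ)
  | ξ, .table n R => .table n (R.ren ξ)
  | ξ, .trLit M => .trLit (M.tren ξ)
  | ξ, .trIf M => .trIf (M.tren ξ)
  | ξ, .trFor C M => .trFor (C.ren ξ) (M.tren ξ)
  | ξ, .trCell M => .trCell (M.tren ξ)
  | ξ, .trOpEq C M => .trOpEq (C.ren ξ) (M.tren ξ)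
  | ξ, .trOpPlus M => .trOpPlus (M.tren ξ)
  | ξ, .tracecase M ML MI MF MC ME MP =>
      .tracecase (M.tren ξ) (ML.tren ξ) (MI.tren ξ) (MF.tren (liftRen ξ)) (MC.tren ξ)
        (ME.tren (liftRen ξ)) (MP.tren ξ)
  | ξ, .typecase C MB MI MS ML MR MT =>
      .typecase (C.ren ξ) (MB.tren ξ) (MI.tren ξ) (MS.tren ξ) (ML.tren (liftRen ξ))
        (MR.tren (liftRen ξ)) (MT.tren (liftRen ξ))

/-- Substitution for type and row variables in terms. -/
def Tm.tsubst : TSub → Tm → Tm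
  | _, .const c => .const c
  | _, .var n => .var n
  | σ, .lam A M => .lam (A.subst σ) (M.tsubst σ)
  | σ, .app M N => .app (M.tsubst σ) (N.tsubst σ)
  | σ, .tlam K M => .tlam K (M.tsubst σ.lift)
  | σ, .tapp M C => .tapp (M.tsubst σ) (C.subst σ)
  | σ, .fix A M => .fix (A.subst σ) (M.tsubst σ)
  | σ, .ite L M N => .ite (L.tsubst σ) (M.tsubst σ) (N.tsubst σ)
  | σ, .plus M N => .plus (M.tsubst σ) (N.tsubst σ)
  | σ, .eq M N => .eq (M.tsubst σ) (N.tsubst σ)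
  | _, .unit => .unit
  | σ, .ext l M N => .ext l (M.tsubst σ) (N.tsubst σ)
  | σ, .proj M l => .proj (M.tsubst σ) l
  | σ, .rmap S M N => .rmap (S.subst σ) (M.tsubst σ) (N.tsubst σ)
  | σ, .rfold S L M N => .rfold (S.subst σ) (L.tsubst σ) (M.tsubst σ) (N.tsubst σ)
  | _, .nil => .nil
  | σ, .single M => .single (M.tsubst σ)
  | σ, .append M N => .append (M.tsubst σ) (N.tsubst σ)
  | σ, .for M N => .for (M.tsubst σ) (N.tsubst σ)
  | σ, .table n R => .table n (R.subst σ)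
  | σ, .trLit M => .trLit (M.tsubst σ)
  | σ, .trIf M => .trIf (M.tsubst σ)
  | σ, .trFor C M => .trFor (C.subst σ) (M.tsubst σ)
  | σ, .trCell M => .trCell (M.tsubst σ)
  | σ, .trOpEq C M => .trOpEq (C.subst σ) (M.tsubst σ)
  | σ, .trOpPlus M => .trOpPlus (M.tsubst σ)
  | σ, .tracecase M ML MI MF MC ME MP =>
      .tracecase (M.tsubst σ) (ML.tsubst σ) (MI.tsubst σ) (MF.tsubst σ.lift) (MC.tsubst σ)
        (ME.tsubst σ.lift) (MP.tsubst σ)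
  | σ, .typecase C MB MI MS ML MR MT =>
      .typecase (C.subst σ) (MB.tsubst σ) (MI.tsubst σ) (MS.tsubst σ) (ML.tsubst σ.lift)
        (MR.tsubst σ.lift) (MT.tsubst σ.lift)

/-- Renaming of term variables. -/
def Tm.ren : (ℕ → ℕ) → Tm → Tm
  | _, .const c => .const c
  | ξ, .var n => .var (ξ n)
  | ξ, .lam A M => .lam A (M.ren (liftRen ξ))
  | ξ, .app M N => .app (M.ren ξ) (N.ren ξ)
  | ξ, .tlam K M => .tlam K (M.ren ξ)
  | ξ, .tapp M C => .tapp (M.ren ξ) C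
  | ξ, .fix A M => .fix A (M.ren (liftRen ξ))
  | ξ, .ite L M N => .ite (L.ren ξ) (M.ren ξ) (N.ren ξ)
  | ξ, .plus M N => .plus (M.ren ξ) (N.ren ξ)
  | ξ, .eq M N => .eq (M.ren ξ) (N.ren ξ)
  | _, .unit => .unit
  | ξ, .ext l M N => .ext l (M.ren ξ) (N.ren ξ)
  | ξ, .proj M l => .proj (M.ren ξ) l
  | ξ, .rmap S M N => .rmap S (M.ren ξ) (N.ren ξ)
  | ξ, .rfold S L M N => .rfold S (L.ren ξ) (M.ren ξ) (N.ren ξ)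
  | _, .nil => .nil
  | ξ, .single M => .single (M.ren ξ)
  | ξ, .append M N => .append (M.ren ξ) (N.ren ξ)
  | ξ, .for M N => .for (M.ren ξ) (N.ren (liftRen ξ))
  | _, .table n R => .table n R
  | ξ, .trLit M => .trLit (M.ren ξ)
  | ξ, .trIf M => .trIf (M.ren ξ)
  | ξ, .trFor C M => .trFor C (M.ren ξ)
  | ξ, .trCell M => .trCell (M.ren ξ)
  | ξ, .trOpEq C M => .trOpEq C (M.ren ξ)
  | ξ, .trOpPlus M => .trOpPlus (M.ren ξ)
  | ξ, .tracecase M ML MI MF MC ME MP =>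
      .tracecase (M.ren ξ) (ML.ren (liftRen ξ)) (MI.ren (liftRen ξ)) (MF.ren (liftRen ξ))
        (MC.ren (liftRen ξ)) (ME.ren (liftRen ξ)) (MP.ren (liftRen ξ))
  | ξ, .typecase C MB MI MS ML MR MT =>
      .typecase C (MB.ren ξ) (MI.ren ξ) (MS.ren ξ) (ML.ren ξ) (MR.ren ξ) (MT.ren ξ)

/-- A term substitution under a binder of a term variable. -/
def liftSub (τ : ℕ → Tm) : ℕ → Tm
  | 0 => .var 0
  | n + 1 => (τ n).ren Nat.succ

/-- A term substitution under a binder of a type or row variable. -/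
def tliftSub (τ : ℕ → Tm) : ℕ → Tm := fun n => (τ n).tren Nat.succ

/-- Substitution for term variables. -/
def Tm.subst : (ℕ → Tm) → Tm → Tm
  | _, .const c => .const c
  | τ, .var n => τ n
  | τ, .lam A M => .lam A (M.subst (liftSub τ))
  | τ, .app M N => .app (M.subst τ) (N.subst τ)
  | τ, .tlam K M => .tlam K (M.subst (tliftSub τ))
  | τ, .tapp M C => .tapp (M.subst τ) C
  | τ, .fix A M => .fix A (M.subst (liftSub τ))
  | τ, .ite L M N => .ite (L.subst τ) (M.subst τ) (N.subst τ)
  | τ, .plus M N => .plus (M.subst τ) (N.subst τ)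
  | τ, .eq M N => .eq (M.subst τ) (N.subst τ)
  | _, .unit => .unit
  | τ, .ext l M N => .ext l (M.subst τ) (N.subst τ)
  | τ, .proj M l => .proj (M.subst τ) l
  | τ, .rmap S M N => .rmap S (M.subst τ) (N.subst τ)
  | τ, .rfold S L M N => .rfold S (L.subst τ) (M.subst τ) (N.subst τ)
  | _, .nil => .nil
  | τ, .single M => .single (M.subst τ)
  | τ, .append M N => .append (M.subst τ) (N.subst τ)
  | τ, .for M N => .for (M.subst τ) (N.subst (liftSub τ))
  | _, .table n R => .table n R
  | τ, .trLit M => .trLit (M.subst τ)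
  | τ, .trIf M => .trIf (M.subst τ)
  | τ, .trFor C M => .trFor C (M.subst τ)
  | τ, .trCell M => .trCell (M.subst τ)
  | τ, .trOpEq C M => .trOpEq C (M.subst τ)
  | τ, .trOpPlus M => .trOpPlus (M.subst τ)
  | τ, .tracecase M ML MI MF MC ME MP =>
      .tracecase (M.subst τ) (ML.subst (liftSub τ)) (MI.subst (liftSub τ))
        (MF.subst (liftSub (tliftSub τ))) (MC.subst (liftSub τ))
        (ME.subst (liftSub (tliftSub τ))) (MP.subst (liftSub τ))
  | τ, .typecase C MB MI MS ML MR MT =>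
      .typecase C (MB.subst τ) (MI.subst τ) (MS.subst τ) (ML.subst (tliftSub τ))
        (MR.subst (tliftSub τ)) (MT.subst (tliftSub τ))

/-- `C[α := D]`, for the last bound type or row variable. -/
abbrev Con.inst {s s' : Srt} (C : Con s) (D : Con s') : Con s := C.subst (TSub.inst D)

/-- `A[α := D]`, for the last bound type or row variable. -/
abbrev Ty.inst {s s' : Srt} (A : Ty s) (D : Con s') : Ty s := A.subst (TSub.inst D)

/-- `M[α := D]`, for the last bound type or row variable. -/
abbrev Tm.tinst {s' : Srt} (M : Tm) (D : Con s') : Tm := M.tsubst (TSub.inst D)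

/-- `M[x := N]`, for the last bound term variable. -/
def Tm.inst (M N : Tm) : Tm :=
  M.subst fun n => match n with
    | 0 => N
    | n + 1 => .var n

/-! ### Kinding -/

/-- Subkinding generated by `BaseType ≤ Type` and `BaseRow ≤ Row`. -/
inductive Subkind : Kind → Kind → Prop
  | refl (K : Kind) : Subkind K K
  | baseType : Subkind .baseType .type
  | baseRow : Subkind .baseRow .row
  | arr {K₁ K₁' K₂ K₂' : Kind} :
      Subkind K₁' K₁ → Subkind K₂ K₂' → Subkind (.arr K₁ K₂) (.arr K₁' K₂')

/-- Kinding `Δ ⊢ C : K` and `Δ ⊢ S : K` of constructors and row constructors. -/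
inductive HasKind : List Kind → {s : Srt} → Con s → Kind → Prop
  | sub {Δ} {s : Srt} {C : Con s} {K K' : Kind} :
      HasKind Δ C K → Subkind K K' → HasKind Δ C K'
  | bool {Δ} : HasKind Δ .bool .baseType
  | int {Δ} : HasKind Δ .int .baseType
  | str {Δ} : HasKind Δ .str .baseType
  | var {Δ : List Kind} {s : Srt} {n : ℕ} {K : Kind} :
      Δ[n]? = some K → s = K.srt → HasKind Δ (.var s n) K
  | lam {Δ} {K₁ K₂ : Kind} {C : Con .con} :
      HasKind (K₁ :: Δ) C K₂ → HasKind Δ (.lam K₁ C) (.arr K₁ K₂)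
  | app {Δ} {s : Srt} {K₁ K₂ : Kind} {C : Con .con} {D : Con s} :
      HasKind Δ C (.arr K₁ K₂) → s = K₁.srt → HasKind Δ D K₁ → HasKind Δ (.app C D) K₂
  | list {Δ} {C : Con .con} : HasKind Δ C .type → HasKind Δ (.list C) .type
  | record {Δ} {S : Con .row} : HasKind Δ S .row → HasKind Δ (.record S) .type
  | trace {Δ} {C : Con .con} : HasKind Δ C .baseType → HasKind Δ (.trace C) .type
  | typerec {Δ} {K : Kind} {C CB CI CS CL CR CT : Con .con} :
      HasKind Δ C .type → HasKind Δ CB K → HasKind Δ CI K → HasKind Δ CS K →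
      HasKind Δ CL (.arr .type (.arr K K)) →
      HasKind Δ CR (.arr .row (.arr .row K)) →
      HasKind Δ CT (.arr .baseType (.arr K K)) →
      HasKind Δ (.typerec C CB CI CS CL CR CT) K
  | nil {Δ} : HasKind Δ .nil .row
  | nilBase {Δ} : HasKind Δ .nil .baseRow
  | cons {Δ} {l : Label} {C : Con .con} {S : Con .row} :
      HasKind Δ C .type → HasKind Δ S .row → HasKind Δ (.cons l C S) .row
  | consBase {Δ} {l : Label} {C : Con .con} {S : Con .row} :
      HasKind Δ C .baseType → HasKind Δ S .baseRow → HasKind Δ (.cons l C S) .baseRow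
  | rmap {Δ} {C : Con .con} {S : Con .row} :
      HasKind Δ C (.arr .type .type) → HasKind Δ S .row → HasKind Δ (.rmap C S) .row

/-- Kinding `Δ ⊢ A : K` and `Δ ⊢ R : K` of types and row types. -/
inductive TyKind : List Kind → {s : Srt} → Ty s → Kind → Prop
  | sub {Δ} {s : Srt} {A : Ty s} {K K' : Kind} : TyKind Δ A K → Subkind K K' → TyKind Δ A K'
  | T {Δ} {C : Con .con} : HasKind Δ C .type → TyKind Δ (.T C) .type
  | TBase {Δ} {C : Con .con} : HasKind Δ C .baseType → TyKind Δ (.T C) .baseType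
  | bool {Δ} : TyKind Δ .bool .baseType
  | int {Δ} : TyKind Δ .int .baseType
  | str {Δ} : TyKind Δ .str .baseType
  | all {Δ} {K : Kind} {A : Ty .con} : TyKind (K :: Δ) A .type → TyKind Δ (.all K A) .type
  | fn {Δ} {A B : Ty .con} : TyKind Δ A .type → TyKind Δ B .type → TyKind Δ (.fn A B) .type
  | list {Δ} {A : Ty .con} : TyKind Δ A .type → TyKind Δ (.list A) .type
  | record {Δ} {R : Ty .row} : TyKind Δ R .row → TyKind Δ (.record R) .type
  | trace {Δ} {A : Ty .con} : TyKind Δ A .baseType → TyKind Δ (.trace A) .type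
  | TRow {Δ} {S : Con .row} : HasKind Δ S .row → TyKind Δ (.T S) .row
  | TBaseRow {Δ} {S : Con .row} : HasKind Δ S .baseRow → TyKind Δ (.T S) .baseRow
  | nil {Δ} : TyKind Δ .nil .row
  | nilBase {Δ} : TyKind Δ .nil .baseRow
  | cons {Δ} {l : Label} {A : Ty .con} {R : Ty .row} :
      TyKind Δ A .type → TyKind Δ R .row → TyKind Δ (.cons l A R) .row
  | consBase {Δ} {l : Label} {A : Ty .con} {R : Ty .row} :
      TyKind Δ A .baseType → TyKind Δ R .baseRow → TyKind Δ (.cons l A R) .baseRow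

/-- Well-formed contexts. -/
def CtxWF (Δ : List Kind) (Γ : List (Ty .con)) : Prop := ∀ A ∈ Γ, TyKind Δ A .type

/-! ### Computation and equivalence of constructors -/

/-- The reduction relation `C ⇝ C'`, `S ⇝ S'` on constructors and row constructors. -/
inductive Con.Red : {s : Srt} → Con s → Con s → Prop
  | consTail {l : Label} {C : Con .con} {S S' : Con .row} :
      Con.Red S S' → Con.Red (.cons l C S) (.cons l C S')
  | consHead {l : Label} {C C' : Con .con} {S : Con .row} :
      Con.Red C C' → Con.Red (.cons l C S) (.cons l C' S)
  | appFun {s : Srt} {C C' : Con .con} {D : Con s} :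
      Con.Red C C' → Con.Red (.app C D) (.app C' D)
  | appArg {s : Srt} {C : Con .con} {D D' : Con s} :
      Con.Red D D' → Con.Red (.app C D) (.app C D')
  | beta {s : Srt} {K : Kind} {C : Con .con} {D : Con s} :
      s = K.srt → Con.Red (.app (.lam K C) D) (C.inst D)
  | lam {K : Kind} {C C' : Con .con} : Con.Red C C' → Con.Red (.lam K C) (.lam K C')
  | list {C C' : Con .con} : Con.Red C C' → Con.Red (.list C) (.list C')
  | trace {C C' : Con .con} : Con.Red C C' → Con.Red (.trace C) (.trace C')
  | record {S S' : Con .row} : Con.Red S S' → Con.Red (.record S) (.record S')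
  | rmapNil {C : Con .con} : Con.Red (.rmap C .nil) .nil
  | rmapCons {l : Label} {C D : Con .con} {S : Con .row} :
      Con.Red (.rmap C (.cons l D S)) (.cons l (.app C D) (.rmap C S))
  | rmapRow {C : Con .con} {S S' : Con .row} :
      Con.Red S S' → Con.Red (.rmap C S) (.rmap C S')
  | rmapFun {C C' : Con .con} {S : Con .row} :
      Con.Red C C' → Con.Red (.rmap C S) (.rmap C' S)
  | trScrut {C C' CB CI CS CL CR CT : Con .con} : Con.Red C C' →
      Con.Red (.typerec C CB CI CS CL CR CT) (.typerec C' CB CI CS CL CR CT)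
  | trB {C CB CB' CI CS CL CR CT : Con .con} : Con.Red CB CB' →
      Con.Red (.typerec C CB CI CS CL CR CT) (.typerec C CB' CI CS CL CR CT)
  | trI {C CB CI CI' CS CL CR CT : Con .con} : Con.Red CI CI' →
      Con.Red (.typerec C CB CI CS CL CR CT) (.typerec C CB CI' CS CL CR CT)
  | trS {C CB CI CS CS' CL CR CT : Con .con} : Con.Red CS CS' →
      Con.Red (.typerec C CB CI CS CL CR CT) (.typerec C CB CI CS' CL CR CT)
  | trL {C CB CI CS CL CL' CR CT : Con .con} : Con.Red CL CL' →
      Con.Red (.typerec C CB CI CS CL CR CT) (.typerec C CB CI CS CL' CR CT)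
  | trR {C CB CI CS CL CR CR' CT : Con .con} : Con.Red CR CR' →
      Con.Red (.typerec C CB CI CS CL CR CT) (.typerec C CB CI CS CL CR' CT)
  | trT {C CB CI CS CL CR CT CT' : Con .con} : Con.Red CT CT' →
      Con.Red (.typerec C CB CI CS CL CR CT) (.typerec C CB CI CS CL CR CT')
  | trBool {CB CI CS CL CR CT : Con .con} : Con.Red (.typerec .bool CB CI CS CL CR CT) CB
  | trInt {CB CI CS CL CR CT : Con .con} : Con.Red (.typerec .int CB CI CS CL CR CT) CI
  | trStr {CB CI CS CL CR CT : Con .con} : Con.Red (.typerec .str CB CI CS CL CR CT) CS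
  | trList {D CB CI CS CL CR CT : Con .con} :
      Con.Red (.typerec (.list D) CB CI CS CL CR CT)
        (.app (.app CL D) (.typerec D CB CI CS CL CR CT))
  | trRecord {S : Con .row} {CB CI CS CL CR CT : Con .con} :
      Con.Red (.typerec (.record S) CB CI CS CL CR CT)
        (.app (.app CR S)
          (.rmap (.lam .type
            (.typerec (.var .con 0) CB.wk CI.wk CS.wk CL.wk CR.wk CT.wk)) S))
  | trTrace {D CB CI CS CL CR CT : Con .con} :
      Con.Red (.typerec (.trace D) CB CI CS CL CR CT)
        (.app (.app CT D) (.typerec D CB CI CS CL CR CT))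

/-- Equivalence `Δ ⊢ C = D : K` of constructors and of row constructors. -/
inductive ConEq : List Kind → {s : Srt} → Con s → Con s → Kind → Prop
  | refl {Δ} {s : Srt} {C : Con s} {K : Kind} : HasKind Δ C K → ConEq Δ C C K
  | symm {Δ} {s : Srt} {C D : Con s} {K : Kind} : ConEq Δ D C K → ConEq Δ C D K
  | trans {Δ} {s : Srt} {C C' C'' : Con s} {K : Kind} :
      ConEq Δ C C' K → ConEq Δ C' C'' K → ConEq Δ C C'' K
  | sub {Δ} {s : Srt} {C D : Con s} {K K' : Kind} :
      ConEq Δ C D K → Subkind K K' → ConEq Δ C D K'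
  | eta {Δ} {C : Con .con} {K K' : Kind} :
      HasKind Δ C (.arr K K') →
      ConEq Δ (.lam K (.app C.wk (.var K.srt 0))) C (.arr K K')
  | lam {Δ} {C D : Con .con} {K K' : Kind} :
      ConEq (K :: Δ) C D K' → ConEq Δ (.lam K C) (.lam K D) (.arr K K')
  | app {Δ} {s : Srt} {C C' : Con .con} {D D' : Con s} {K K' : Kind} :
      ConEq Δ C C' (.arr K' K) → s = K'.srt → ConEq Δ D D' K' →
      ConEq Δ (.app C D) (.app C' D') K
  | list {Δ} {C D : Con .con} : ConEq Δ C D .type → ConEq Δ (.list C) (.list D) .type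
  | record {Δ} {S S' : Con .row} :
      ConEq Δ S S' .row → ConEq Δ (.record S) (.record S') .type
  | trace {Δ} {C D : Con .con} : ConEq Δ C D .baseType → ConEq Δ (.trace C) (.trace D) .type
  | red {Δ} {s : Srt} {C D : Con s} {K : Kind} :
      HasKind Δ C K → HasKind Δ D K → Con.Red C D → ConEq Δ C D K
  | nil {Δ} : ConEq Δ .nil .nil .row
  | cons {Δ} {l : Label} {C D : Con .con} {S S' : Con .row} :
      ConEq Δ C D .type → ConEq Δ S S' .row → ConEq Δ (.cons l C S) (.cons l D S') .row
  | consBase {Δ} {l : Label} {C D : Con .con} {S S' : Con .row} :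
      ConEq Δ C D .baseType → ConEq Δ S S' .baseRow →
      ConEq Δ (.cons l C S) (.cons l D S') .baseRow
  | rmap {Δ} {C D : Con .con} {S S' : Con .row} :
      ConEq Δ C D (.arr .type .type) → ConEq Δ S S' .row →
      ConEq Δ (.rmap C S) (.rmap D S') .row
  | typerec {Δ} {K : Kind} {C C' CB CB' CI CI' CS CS' CL CL' CR CR' CT CT' : Con .con} :
      ConEq Δ C C' .type → ConEq Δ CB CB' K → ConEq Δ CI CI' K → ConEq Δ CS CS' K →
      ConEq Δ CL CL' (.arr .type (.arr K K)) →
      ConEq Δ CR CR' (.arr .row (.arr .row K)) →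
      ConEq Δ CT CT' (.arr .baseType (.arr K K)) →
      ConEq Δ (.typerec C CB CI CS CL CR CT) (.typerec C' CB' CI' CS' CL' CR' CT') K

/-- Equivalence `Δ ⊢ A = B : K` of types and of row types. -/
inductive TyEq : List Kind → {s : Srt} → Ty s → Ty s → Kind → Prop
  | refl {Δ} {s : Srt} {A : Ty s} {K : Kind} : TyKind Δ A K → TyEq Δ A A K
  | symm {Δ} {s : Srt} {A B : Ty s} {K : Kind} : TyEq Δ B A K → TyEq Δ A B K
  | trans {Δ} {s : Srt} {A B C : Ty s} {K : Kind} :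
      TyEq Δ A B K → TyEq Δ B C K → TyEq Δ A C K
  | sub {Δ} {s : Srt} {A B : Ty s} {K K' : Kind} :
      TyEq Δ A B K → Subkind K K' → TyEq Δ A B K'
  | TBool {Δ} : TyEq Δ (.T .bool) .bool .baseType
  | TInt {Δ} : TyEq Δ (.T .int) .int .baseType
  | TStr {Δ} : TyEq Δ (.T .str) .str .baseType
  | TList {Δ} {C : Con .con} :
      HasKind Δ C .type → TyEq Δ (.T (.list C)) (.list (.T C)) .type
  | TRecord {Δ} {S : Con .row} :
      HasKind Δ S .row → TyEq Δ (.T (.record S)) (.record (.T S)) .type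
  | TTrace {Δ} {C : Con .con} :
      HasKind Δ C .baseType → TyEq Δ (.T (.trace C)) (.trace (.T C)) .type
  | TNil {Δ} : TyEq Δ (.T .nil) .nil .row
  | TCons {Δ} {l : Label} {C : Con .con} {S : Con .row} :
      HasKind Δ C .type → HasKind Δ S .row →
      TyEq Δ (.T (.cons l C S)) (.cons l (.T C) (.T S)) .row
  | T {Δ} {C D : Con .con} : ConEq Δ C D .type → TyEq Δ (.T C) (.T D) .type
  | TBase {Δ} {C D : Con .con} : ConEq Δ C D .baseType → TyEq Δ (.T C) (.T D) .baseType
  | TRow {Δ} {S S' : Con .row} : ConEq Δ S S' .row → TyEq Δ (.T S) (.T S') .row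
  | TBaseRow {Δ} {S S' : Con .row} : ConEq Δ S S' .baseRow → TyEq Δ (.T S) (.T S') .baseRow
  | list {Δ} {A B : Ty .con} : TyEq Δ A B .type → TyEq Δ (.list A) (.list B) .type
  | record {Δ} {R R' : Ty .row} :
      TyEq Δ R R' .row → TyEq Δ (.record R) (.record R') .type
  | trace {Δ} {A B : Ty .con} : TyEq Δ A B .baseType → TyEq Δ (.trace A) (.trace B) .type
  | fn {Δ} {A A' B B' : Ty .con} :
      TyEq Δ A A' .type → TyEq Δ B B' .type → TyEq Δ (.fn A B) (.fn A' B') .type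
  | all {Δ} {K : Kind} {A B : Ty .con} :
      TyEq (K :: Δ) A B .type → TyEq Δ (.all K A) (.all K B) .type
  | nil {Δ} : TyEq Δ .nil .nil .row
  | cons {Δ} {l : Label} {A B : Ty .con} {R R' : Ty .row} :
      TyEq Δ A B .type → TyEq Δ R R' .row → TyEq Δ (.cons l A R) (.cons l B R') .row
  | consBase {Δ} {l : Label} {A B : Ty .con} {R R' : Ty .row} :
      TyEq Δ A B .baseType → TyEq Δ R R' .baseRow →
      TyEq Δ (.cons l A R) (.cons l B R') .baseRow

/-! ### Typing -/

/-- The signature of the constants. -/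
def Const.ty : Const → Ty .con
  | .bool _ => .bool
  | .int _ => .int
  | .str _ => .str

/-- The type-level function `TRACE`. -/
def TRACE : Con .con :=
  .lam .type (.typerec (.var .con 0) (.trace .bool) (.trace .int) (.trace .str)
    (.lam .type (.lam .type (.list (.var .con 0))))
    (.lam .row (.lam .row (.record (.var .row 0))))
    (.lam .baseType (.lam .type (.var .con 0))))

/-- `T(TRACE C)` -/
def Ty.TTRACE (C : Con .con) : Ty .con := .T (.app TRACE C)

/-- `⟨cond : Trace Bool, out : Trace A⟩` -/
def Ty.ifRec (A : Ty .con) : Ty .con :=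
  .record (.cons .cond (.trace .bool) (.cons .out (.trace A) .nil))

/-- `⟨in : T(TRACE C), out : Trace A⟩` -/
def Ty.forRec (C : Con .con) (A : Ty .con) : Ty .con :=
  .record (.cons .input (.TTRACE C) (.cons .out (.trace A) .nil))

/-- `⟨table : String, column : String, row : Int, data : A⟩` -/
def Ty.cellRec (A : Ty .con) : Ty .con :=
  .record (.cons .table .str (.cons .column .str (.cons .row .int (.cons .data A .nil))))

/-- `⟨left : A, right : A⟩` -/
def Ty.opRec (A : Ty .con) : Ty .con :=
  .record (.cons .left A (.cons .right A .nil))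

/-- A context of term variables, moved under a binder of a type or row variable. -/
abbrev wkCtx (Γ : List (Ty .con)) : List (Ty .con) := Γ.map Ty.wk

/-- Term formation `Δ; Γ ⊢ M : A`. -/
inductive HasType : List Kind → List (Ty .con) → Tm → Ty .con → Prop
  | const {Δ Γ} {c : Const} : HasType Δ Γ (.const c) c.ty
  | var {Δ} {Γ : List (Ty .con)} {n : ℕ} {A : Ty .con} :
      Γ[n]? = some A → HasType Δ Γ (.var n) A
  | lam {Δ Γ} {A B : Ty .con} {M : Tm} :
      TyKind Δ A .type → HasType Δ (A :: Γ) M B → HasType Δ Γ (.lam A M) (.fn A B)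
  | app {Δ Γ} {A B : Ty .con} {M N : Tm} :
      HasType Δ Γ M (.fn A B) → HasType Δ Γ N A → HasType Δ Γ (.app M N) B
  | tlam {Δ Γ} {K : Kind} {A : Ty .con} {M : Tm} :
      HasType (K :: Δ) (wkCtx Γ) M A → HasType Δ Γ (.tlam K M) (.all K A)
  | tapp {Δ Γ} {s : Srt} {K : Kind} {A : Ty .con} {M : Tm} {C : Con s} :
      HasType Δ Γ M (.all K A) → s = K.srt → HasKind Δ C K →
      HasType Δ Γ (.tapp M C) (A.inst C)
  | fix {Δ Γ} {A : Ty .con} {M : Tm} :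
      TyKind Δ A .type → HasType Δ (A :: Γ) M A → HasType Δ Γ (.fix A M) A
  | ite {Δ Γ} {A : Ty .con} {L M N : Tm} :
      HasType Δ Γ L .bool → HasType Δ Γ M A → HasType Δ Γ N A → HasType Δ Γ (.ite L M N) A
  | plus {Δ Γ} {M N : Tm} :
      HasType Δ Γ M .int → HasType Δ Γ N .int → HasType Δ Γ (.plus M N) .int
  | eq {Δ Γ} {A : Ty .con} {M N : Tm} :
      HasType Δ Γ M A → HasType Δ Γ N A → TyKind Δ A .baseType →
      HasType Δ Γ (.eq M N) .bool
  | table {Δ Γ} {n : String} {R : Ty .row} :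
      TyKind [] R .baseRow →
      HasType Δ Γ (.table n (.cons .oid .int R)) (.list (.record (.cons .oid .int R)))
  | nil {Δ Γ} {A : Ty .con} : TyKind Δ A .type → HasType Δ Γ .nil (.list A)
  | single {Δ Γ} {A : Ty .con} {M : Tm} :
      HasType Δ Γ M A → HasType Δ Γ (.single M) (.list A)
  | append {Δ Γ} {A : Ty .con} {M N : Tm} :
      HasType Δ Γ M (.list A) → HasType Δ Γ N (.list A) →
      HasType Δ Γ (.append M N) (.list A)
  | for {Δ Γ} {A B : Ty .con} {M N : Tm} :
      HasType Δ Γ M (.list A) → HasType Δ (A :: Γ) N (.list B) →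
      HasType Δ Γ (.for M N) (.list B)
  | unit {Δ Γ} : CtxWF Δ Γ → HasType Δ Γ .unit (.record .nil)
  | ext {Δ Γ} {l : Label} {A : Ty .con} {R : Ty .row} {M N : Tm} :
      HasType Δ Γ M A → HasType Δ Γ N (.record R) →
      HasType Δ Γ (.ext l M N) (.record (.cons l A R))
  | proj {Δ Γ} {l : Label} {A : Ty .con} {R : Ty .row} {M : Tm} :
      HasType Δ Γ M (.record (.cons l A R)) → HasType Δ Γ (.proj M l) A
  | conv {Δ Γ} {A B : Ty .con} {M : Tm} :
      HasType Δ Γ M B → TyEq Δ A B .type → HasType Δ Γ M A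
  | rmap {Δ Γ} {C : Con .con} {S : Con .row} {M N : Tm} :
      HasKind Δ S .row →
      HasType Δ Γ M (.all .type (.fn (.T (.var .con 0)) (.T (.app C.wk (.var .con 0))))) →
      HasType Δ Γ N (.T (.record S)) →
      HasType Δ Γ (.rmap S M N) (.T (.record (.rmap C S)))
  | rfold {Δ Γ} {C : Con .con} {S : Con .row} {L M N : Tm} :
      HasKind Δ S .row →
      HasType Δ Γ L (.fn (.T C) (.fn (.T C) (.T C))) →
      HasType Δ Γ M (.T C) →
      HasType Δ Γ N (.T (.record (.rmap (.lam .type C.wk) S))) →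
      HasType Δ Γ (.rfold S L M N) (.T C)
  | typecase {Δ Γ} {B : Ty .con} {C : Con .con} {MB MI MS ML MR MT : Tm} :
      HasKind Δ C .type →
      TyKind (.type :: Δ) B .type →
      HasType Δ Γ MB (B.inst Con.bool) →
      HasType Δ Γ MI (B.inst Con.int) →
      HasType Δ Γ MS (B.inst Con.str) →
      HasType (.type :: Δ) (wkCtx Γ) ML
        ((B.ren (liftRen Nat.succ)).inst (Con.list (.var .con 0))) →
      HasType (.row :: Δ) (wkCtx Γ) MR
        ((B.ren (liftRen Nat.succ)).inst (Con.record (.var .row 0))) →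
      HasType (.baseType :: Δ) (wkCtx Γ) MT
        ((B.ren (liftRen Nat.succ)).inst (Con.trace (.var .con 0))) →
      HasType Δ Γ (.typecase C MB MI MS ML MR MT) (B.inst C)
  | litBool {Δ Γ} {M : Tm} : HasType Δ Γ M .bool → HasType Δ Γ (.trLit M) (.trace .bool)
  | litInt {Δ Γ} {M : Tm} : HasType Δ Γ M .int → HasType Δ Γ (.trLit M) (.trace .int)
  | litStr {Δ Γ} {M : Tm} : HasType Δ Γ M .str → HasType Δ Γ (.trLit M) (.trace .str)
  | trIf {Δ Γ} {A : Ty .con} {M : Tm} :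
      HasType Δ Γ M (.ifRec A) → HasType Δ Γ (.trIf M) (.trace A)
  | trFor {Δ Γ} {A : Ty .con} {C : Con .con} {M : Tm} :
      HasKind Δ C .type → HasType Δ Γ M (.forRec C A) → HasType Δ Γ (.trFor C M) (.trace A)
  | trCell {Δ Γ} {A : Ty .con} {M : Tm} :
      HasType Δ Γ M (.cellRec A) → HasType Δ Γ (.trCell M) (.trace A)
  | trOpEq {Δ Γ} {C : Con .con} {M : Tm} :
      HasKind Δ C .baseType → HasType Δ Γ M (.opRec (.TTRACE C)) →
      HasType Δ Γ (.trOpEq C M) (.trace .bool)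
  | trOpPlus {Δ Γ} {M : Tm} :
      HasType Δ Γ M (.opRec (.trace .int)) → HasType Δ Γ (.trOpPlus M) (.trace .int)
  | tracecase {Δ Γ} {A B : Ty .con} {M ML MI MF MC ME MP : Tm} :
      HasType Δ Γ M (.trace A) →
      HasType Δ (A :: Γ) ML B →
      HasType Δ (.ifRec A :: Γ) MI B →
      HasType (.type :: Δ) (.forRec (.var .con 0) A.wk :: wkCtx Γ) MF B.wk →
      HasType Δ (.cellRec A :: Γ) MC B →
      HasType (.baseType :: Δ) (.opRec (.TTRACE (.var .con 0)) :: wkCtx Γ) ME B.wk →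
      HasType Δ (.opRec (.trace .int) :: Γ) MP B →
      HasType Δ Γ (.tracecase M ML MI MF MC ME MP) B

/-! ### Reduction of terms -/

/-- `Maps N l M`: the record expression `N` is a literal `⟨l₁ = M₁; …; lₙ = Mₙ; N'⟩` in which
`M` is the component of the first occurrence of `l` among the `lᵢ`. -/
inductive Maps : Tm → Label → Tm → Prop
  | here {l : Label} {M N : Tm} : Maps (.ext l M N) l M
  | there {k l : Label} {M M' N : Tm} : k ≠ l → Maps N l M' → Maps (.ext k M N) l M'

/-- The closed row `l₁ : C₁; …; lₙ : Cₙ; ·`. -/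
def rowOf : List (Label × Con .con) → Con .row
  | [] => .nil
  | (l, C) :: fs => .cons l C (rowOf fs)

/-- `⟨l₁ = (M C₁) N.l₁; …; lₙ = (M Cₙ) N.lₙ⟩` -/
def rmapOf (M N : Tm) : List (Label × Con .con) → Tm
  | [] => .unit
  | (l, C) :: fs => .ext l (.app (.tapp M C) (.proj N l)) (rmapOf M N fs)

/-- `L N.l₁ (L N.l₂ … (L N.lₙ M) …)` -/
def rfoldOf (L M N : Tm) : List (Label × Con .con) → Tm
  | [] => M
  | (l, _) :: fs => .app (.app L (.proj N l)) (rfoldOf L M N fs)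

/-- The reduction relation `M ⇝ M'` on terms: β-rules, commuting conversions, congruence rules. -/
inductive Tm.Red : Tm → Tm → Prop
  -- β-rules
  | beta {A : Ty .con} {M N : Tm} : Tm.Red (.app (.lam A M) N) (M.inst N)
  | fix {A : Ty .con} {M : Tm} : Tm.Red (.fix A M) (M.inst (.fix A M))
  | tbeta {s : Srt} {K : Kind} {M : Tm} {C : Con s} :
      s = K.srt → Tm.Red (.tapp (.tlam K M) C) (M.tinst C)
  | iteTrue {M N : Tm} : Tm.Red (.ite (.const (.bool true)) M N) M
  | iteFalse {M N : Tm} : Tm.Red (.ite (.const (.bool false)) M N) N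
  | projExt {l : Label} {M N : Tm} : Maps N l M → Tm.Red (.proj N l) M
  | rmapClosed {fs : List (Label × Con .con)} {M N : Tm} :
      Tm.Red (.rmap (rowOf fs) M N) (rmapOf M N fs)
  | rfoldClosed {fs : List (Label × Con .con)} {L M N : Tm} :
      Tm.Red (.rfold (rowOf fs) L M N) (rfoldOf L M N fs)
  | forNil {N : Tm} : Tm.Red (.for .nil N) .nil
  | forSingle {M N : Tm} : Tm.Red (.for (.single M) N) (N.inst M)
  | tcLit {M ML MI MF MC ME MP : Tm} :
      Tm.Red (.tracecase (.trLit M) ML MI MF MC ME MP) (ML.inst M)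
  | tcIf {M ML MI MF MC ME MP : Tm} :
      Tm.Red (.tracecase (.trIf M) ML MI MF MC ME MP) (MI.inst M)
  | tcFor {C : Con .con} {M ML MI MF MC ME MP : Tm} :
      Tm.Red (.tracecase (.trFor C M) ML MI MF MC ME MP) ((MF.tinst C).inst M)
  | tcCell {M ML MI MF MC ME MP : Tm} :
      Tm.Red (.tracecase (.trCell M) ML MI MF MC ME MP) (MC.inst M)
  | tcOpEq {C : Con .con} {M ML MI MF MC ME MP : Tm} :
      Tm.Red (.tracecase (.trOpEq C M) ML MI MF MC ME MP) ((ME.tinst C).inst M)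
  | tcOpPlus {M ML MI MF MC ME MP : Tm} :
      Tm.Red (.tracecase (.trOpPlus M) ML MI MF MC ME MP) (MP.inst M)
  | tyBool {MB MI MS ML MR MT : Tm} : Tm.Red (.typecase .bool MB MI MS ML MR MT) MB
  | tyInt {MB MI MS ML MR MT : Tm} : Tm.Red (.typecase .int MB MI MS ML MR MT) MI
  | tyStr {MB MI MS ML MR MT : Tm} : Tm.Red (.typecase .str MB MI MS ML MR MT) MS
  | tyList {C : Con .con} {MB MI MS ML MR MT : Tm} :
      Tm.Red (.typecase (.list C) MB MI MS ML MR MT) (ML.tinst C)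
  | tyRecord {S : Con .row} {MB MI MS ML MR MT : Tm} :
      Tm.Red (.typecase (.record S) MB MI MS ML MR MT) (MR.tinst S)
  | tyTrace {C : Con .con} {MB MI MS ML MR MT : Tm} :
      Tm.Red (.typecase (.trace C) MB MI MS ML MR MT) (MT.tinst C)
  -- commuting conversions
  | ccApp {L M₁ M₂ N : Tm} :
      Tm.Red (.app (.ite L M₁ M₂) N) (.ite L (.app M₁ N) (.app M₂ N))
  | ccTapp {s : Srt} {L M₁ M₂ : Tm} {C : Con s} :
      Tm.Red (.tapp (.ite L M₁ M₂) C) (.ite L (.tapp M₁ C) (.tapp M₂ C))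
  | ccProj {l : Label} {L M N : Tm} :
      Tm.Red (.proj (.ite L M N) l) (.ite L (.proj M l) (.proj N l))
  | ccForAppend {M₁ M₂ N : Tm} :
      Tm.Red (.for (.append M₁ M₂) N) (.append (.for M₁ N) (.for M₂ N))
  | ccForFor {L M N : Tm} :
      Tm.Red (.for (.for L M) N) (.for L (.for M (N.ren (liftRen Nat.succ))))
  | ccIte {L M₁ M₂ N₁ N₂ : Tm} :
      Tm.Red (.ite (.ite L M₁ M₂) N₁ N₂) (.ite L (.ite M₁ N₁ N₂) (.ite M₂ N₁ N₂))
  | ccForIte {L M₁ M₂ N : Tm} :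
      Tm.Red (.for (.ite L M₁ M₂) N) (.ite L (.for M₁ N) (.for M₂ N))
  | ccTracecase {L M₁ M₂ ML MI MF MC ME MP : Tm} :
      Tm.Red (.tracecase (.ite L M₁ M₂) ML MI MF MC ME MP)
        (.ite L (.tracecase M₁ ML MI MF MC ME MP) (.tracecase M₂ ML MI MF MC ME MP))
  -- congruence rules
  | lam {A : Ty .con} {M M' : Tm} : Tm.Red M M' → Tm.Red (.lam A M) (.lam A M')
  | app₁ {M M' N : Tm} : Tm.Red M M' → Tm.Red (.app M N) (.app M' N)
  | app₂ {M N N' : Tm} : Tm.Red N N' → Tm.Red (.app M N) (.app M N')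
  | tlam {K : Kind} {M M' : Tm} : Tm.Red M M' → Tm.Red (.tlam K M) (.tlam K M')
  | tapp₁ {s : Srt} {M M' : Tm} {C : Con s} :
      Tm.Red M M' → Tm.Red (.tapp M C) (.tapp M' C)
  | tapp₂ {s : Srt} {M : Tm} {C C' : Con s} :
      Con.Red C C' → Tm.Red (.tapp M C) (.tapp M C')
  | ite₁ {L L' M N : Tm} : Tm.Red L L' → Tm.Red (.ite L M N) (.ite L' M N)
  | ite₂ {L M M' N : Tm} : Tm.Red M M' → Tm.Red (.ite L M N) (.ite L M' N)
  | ite₃ {L M N N' : Tm} : Tm.Red N N' → Tm.Red (.ite L M N) (.ite L M N')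
  | ext₁ {l : Label} {M M' N : Tm} : Tm.Red M M' → Tm.Red (.ext l M N) (.ext l M' N)
  | ext₂ {l : Label} {M N N' : Tm} : Tm.Red N N' → Tm.Red (.ext l M N) (.ext l M N')
  | proj {l : Label} {M M' : Tm} : Tm.Red M M' → Tm.Red (.proj M l) (.proj M' l)
  | rmap₁ {S S' : Con .row} {M N : Tm} :
      Con.Red S S' → Tm.Red (.rmap S M N) (.rmap S' M N)
  | rmap₂ {S : Con .row} {M M' N : Tm} : Tm.Red M M' → Tm.Red (.rmap S M N) (.rmap S M' N)
  | rmap₃ {S : Con .row} {M N N' : Tm} : Tm.Red N N' → Tm.Red (.rmap S M N) (.rmap S M N')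
  | rfold₁ {S S' : Con .row} {L M N : Tm} :
      Con.Red S S' → Tm.Red (.rfold S L M N) (.rfold S' L M N)
  | rfold₂ {S : Con .row} {L L' M N : Tm} :
      Tm.Red L L' → Tm.Red (.rfold S L M N) (.rfold S L' M N)
  | rfold₃ {S : Con .row} {L M M' N : Tm} :
      Tm.Red M M' → Tm.Red (.rfold S L M N) (.rfold S L M' N)
  | rfold₄ {S : Con .row} {L M N N' : Tm} :
      Tm.Red N N' → Tm.Red (.rfold S L M N) (.rfold S L M N')
  | single {M M' : Tm} : Tm.Red M M' → Tm.Red (.single M) (.single M')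
  | append₁ {M M' N : Tm} : Tm.Red M M' → Tm.Red (.append M N) (.append M' N)
  | append₂ {M N N' : Tm} : Tm.Red N N' → Tm.Red (.append M N) (.append M N')
  | eq₁ {M M' N : Tm} : Tm.Red M M' → Tm.Red (.eq M N) (.eq M' N)
  | eq₂ {M N N' : Tm} : Tm.Red N N' → Tm.Red (.eq M N) (.eq M N')
  | plus₁ {M M' N : Tm} : Tm.Red M M' → Tm.Red (.plus M N) (.plus M' N)
  | plus₂ {M N N' : Tm} : Tm.Red N N' → Tm.Red (.plus M N) (.plus M N')
  | for₁ {M M' N : Tm} : Tm.Red M M' → Tm.Red (.for M N) (.for M' N)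
  | for₂ {M N N' : Tm} : Tm.Red N N' → Tm.Red (.for M N) (.for M N')
  | trLit {M M' : Tm} : Tm.Red M M' → Tm.Red (.trLit M) (.trLit M')
  | trIf {M M' : Tm} : Tm.Red M M' → Tm.Red (.trIf M) (.trIf M')
  | trFor₁ {C C' : Con .con} {M : Tm} : Con.Red C C' → Tm.Red (.trFor C M) (.trFor C' M)
  | trFor₂ {C : Con .con} {M M' : Tm} : Tm.Red M M' → Tm.Red (.trFor C M) (.trFor C M')
  | trCell {M M' : Tm} : Tm.Red M M' → Tm.Red (.trCell M) (.trCell M')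
  | trOpEq₁ {C C' : Con .con} {M : Tm} : Con.Red C C' → Tm.Red (.trOpEq C M) (.trOpEq C' M)
  | trOpEq₂ {C : Con .con} {M M' : Tm} : Tm.Red M M' → Tm.Red (.trOpEq C M) (.trOpEq C M')
  | trOpPlus {M M' : Tm} : Tm.Red M M' → Tm.Red (.trOpPlus M) (.trOpPlus M')
  | tcScrut {M M' ML MI MF MC ME MP : Tm} : Tm.Red M M' →
      Tm.Red (.tracecase M ML MI MF MC ME MP) (.tracecase M' ML MI MF MC ME MP)
  | tcL {M ML ML' MI MF MC ME MP : Tm} : Tm.Red ML ML' →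
      Tm.Red (.tracecase M ML MI MF MC ME MP) (.tracecase M ML' MI MF MC ME MP)
  | tcI {M ML MI MI' MF MC ME MP : Tm} : Tm.Red MI MI' →
      Tm.Red (.tracecase M ML MI MF MC ME MP) (.tracecase M ML MI' MF MC ME MP)
  | tcF {M ML MI MF MF' MC ME MP : Tm} : Tm.Red MF MF' →
      Tm.Red (.tracecase M ML MI MF MC ME MP) (.tracecase M ML MI MF' MC ME MP)
  | tcC {M ML MI MF MC MC' ME MP : Tm} : Tm.Red MC MC' →
      Tm.Red (.tracecase M ML MI MF MC ME MP) (.tracecase M ML MI MF MC' ME MP)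
  | tcE {M ML MI MF MC ME ME' MP : Tm} : Tm.Red ME ME' →
      Tm.Red (.tracecase M ML MI MF MC ME MP) (.tracecase M ML MI MF MC ME' MP)
  | tcP {M ML MI MF MC ME MP MP' : Tm} : Tm.Red MP MP' →
      Tm.Red (.tracecase M ML MI MF MC ME MP) (.tracecase M ML MI MF MC ME MP')
  | tyScrut {C C' : Con .con} {MB MI MS ML MR MT : Tm} : Con.Red C C' →
      Tm.Red (.typecase C MB MI MS ML MR MT) (.typecase C' MB MI MS ML MR MT)
  | tyB {C : Con .con} {MB MB' MI MS ML MR MT : Tm} : Tm.Red MB MB' →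
      Tm.Red (.typecase C MB MI MS ML MR MT) (.typecase C MB' MI MS ML MR MT)
  | tyI {C : Con .con} {MB MI MI' MS ML MR MT : Tm} : Tm.Red MI MI' →
      Tm.Red (.typecase C MB MI MS ML MR MT) (.typecase C MB MI' MS ML MR MT)
  | tyS {C : Con .con} {MB MI MS MS' ML MR MT : Tm} : Tm.Red MS MS' →
      Tm.Red (.typecase C MB MI MS ML MR MT) (.typecase C MB MI MS' ML MR MT)
  | tyL {C : Con .con} {MB MI MS ML ML' MR MT : Tm} : Tm.Red ML ML' →
      Tm.Red (.typecase C MB MI MS ML MR MT) (.typecase C MB MI MS ML' MR MT)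
  | tyR {C : Con .con} {MB MI MS ML MR MR' MT : Tm} : Tm.Red MR MR' →
      Tm.Red (.typecase C MB MI MS ML MR MT) (.typecase C MB MI MS ML MR' MT)
  | tyT {C : Con .con} {MB MI MS ML MR MT MT' : Tm} : Tm.Red MT MT' →
      Tm.Red (.typecase C MB MI MS ML MR MT) (.typecase C MB MI MS ML MR MT')

/-! ### Normal forms -/

mutual

/-- Normal constructors `C`. -/
inductive NormalC : Con .con → Prop
  | neutral {E : Con .con} : NeutralC E → NormalC E
  | bool : NormalC .bool
  | int : NormalC .int
  | str : NormalC .str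
  | lam {K : Kind} {C : Con .con} : NormalC C → NormalC (.lam K C)
  | list {C : Con .con} : NormalC C → NormalC (.list C)
  | record {S : Con .row} : NormalR S → NormalC (.record S)
  | trace {C : Con .con} : NormalC C → NormalC (.trace C)

/-- Neutral constructors `E`. -/
inductive NeutralC : Con .con → Prop
  | var {n : ℕ} : NeutralC (.var .con n)
  | appC {E C : Con .con} : NeutralC E → NormalC C → NeutralC (.app E C)
  | appR {E : Con .con} {S : Con .row} : NeutralC E → NormalR S → NeutralC (.app E S)
  | typerec {E CB CI CS CL CR CT : Con .con} :
      NeutralC E → NormalC CB → NormalC CI → NormalC CS → NormalC CL → NormalC CR →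
      NormalC CT → NeutralC (.typerec E CB CI CS CL CR CT)

/-- Normal row constructors `S`. -/
inductive NormalR : Con .row → Prop
  | nil : NormalR .nil
  | cons {l : Label} {C : Con .con} {S : Con .row} :
      NormalC C → NormalR S → NormalR (.cons l C S)
  | neutral {U : Con .row} : NeutralR U → NormalR U

/-- Neutral row constructors `U`. -/
inductive NeutralR : Con .row → Prop
  | var {n : ℕ} : NeutralR (.var .row n)
  | cons {l : Label} {C : Con .con} {U : Con .row} :
      NormalC C → NeutralR U → NeutralR (.cons l C U)
  | rmap {C : Con .con} {U : Con .row} : NormalC C → NeutralR U → NeutralR (.rmap C U)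

end

mutual

/-- Normal terms `M`, `N`. -/
inductive Normal : Tm → Prop
  | neutral {F : Tm} : Neutral F → Normal F
  | const {c : Const} : Normal (.const c)
  | lam {A : Ty .con} {M : Tm} : Normal M → Normal (.lam A M)
  | tlam {K : Kind} {M : Tm} : Normal M → Normal (.tlam K M)
  | ite {H M N : Tm} : NeutralCond H → Normal M → Normal N → Normal (.ite H M N)
  | plus {M N : Tm} : Normal M → Normal N → Normal (.plus M N)
  | eq {M N : Tm} : Normal M → Normal N → Normal (.eq M N)
  | unit : Normal .unit
  | ext {l : Label} {M N : Tm} : Normal M → Normal N → Normal (.ext l M N)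
  | rmap {U : Con .row} {M N : Tm} :
      NeutralR U → Normal M → Normal N → Normal (.rmap U M N)
  | nil : Normal .nil
  | single {M : Tm} : Normal M → Normal (.single M)
  | append {M N : Tm} : Normal M → Normal N → Normal (.append M N)
  | for {T N : Tm} : NeutralTable T → Normal N → Normal (.for T N)
  | table {n : String} {R : Ty .row} : Normal (.table n R)
  | trLit {M : Tm} : Normal M → Normal (.trLit M)
  | trIf {M : Tm} : Normal M → Normal (.trIf M)
  | trFor {C : Con .con} {M : Tm} : NormalC C → Normal M → Normal (.trFor C M)
  | trCell {M : Tm} : Normal M → Normal (.trCell M)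
  | trOpEq {C : Con .con} {M : Tm} : NormalC C → Normal M → Normal (.trOpEq C M)
  | trOpPlus {M : Tm} : Normal M → Normal (.trOpPlus M)

/-- Neutral terms `F`. -/
inductive Neutral : Tm → Prop
  | var {n : ℕ} : Neutral (.var n)
  | proj {P : Tm} {l : Label} : NeutralProj P → Neutral (.proj P l)
  | app {F M : Tm} : Neutral F → Normal M → Neutral (.app F M)
  | tappC {F : Tm} {C : Con .con} : Neutral F → NormalC C → Neutral (.tapp F C)
  | tappR {F : Tm} {S : Con .row} : Neutral F → NormalR S → Neutral (.tapp F S)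
  | rfold {U : Con .row} {L M N : Tm} :
      NeutralR U → Normal L → Normal M → Normal N → Neutral (.rfold U L M N)
  | tracecase {F ML MI MF MC ME MP : Tm} :
      Neutral F → Normal ML → Normal MI → Normal MF → Normal MC → Normal ME → Normal MP →
      Neutral (.tracecase F ML MI MF MC ME MP)
  | typecase {E : Con .con} {MB MI MS ML MR MT : Tm} :
      NeutralC E → Normal MB → Normal MI → Normal MS → Normal ML → Normal MR → Normal MT →
      Neutral (.typecase E MB MI MS ML MR MT)

/-- Neutral conditionals `H`. -/
inductive NeutralCond : Tm → Prop
  | neutral {F : Tm} : Neutral F → NeutralCond F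
  | eq {M N : Tm} : Normal M → Normal N → NeutralCond (.eq M N)

/-- Neutral projections `P`. -/
inductive NeutralProj : Tm → Prop
  | neutral {F : Tm} : Neutral F → NeutralProj F
  | rmap {U : Con .row} {M N : Tm} :
      NeutralR U → Normal M → Normal N → NeutralProj (.rmap U M N)

/-- Neutral tables `T`. -/
inductive NeutralTable : Tm → Prop
  | neutral {F : Tm} : Neutral F → NeutralTable F
  | table {n : String} {R : Ty .row} : NeutralTable (.table n R)

end

end LinksT

namespace LinksT

/-! ### A set-theoretic model of constructors -/

-- Progress is an induction on typing whose only serious content is canonical forms: a normal term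
-- standing in an elimination position must be neutral, a matching introduction form, or a form for
-- which a commuting conversion exists. Since terms may change type along type equivalence, this
-- requires consistency: function types, lists, records, traces, quantified types and the base types
-- are pairwise inequivalent, and equivalent record types agree on their first label.
--
-- Consistency is usually read off from confluence and normalization of constructor reduction. Here
-- it comes from a set-theoretic model. `Type` and `Row` are interpreted as the sets of closed
-- constructor values and rows of values, arrow kinds as full function spaces, and `Typerec` as
-- structural recursion on values. Base kinds are identified with their super-kinds, so subkinding
-- becomes equality. The denotation is a relation `Den` on raw constructors. It is functional
-- (`Den.unique`), total on well-kinded constructors (`HasKind.exists_den`), and equivalent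
-- constructors share a value (`ConEq.exists_den`). Every type then has an outermost symbol in each
-- environment, invariant under equivalence (`TyEq.exists_head`). As no kind is empty, an
-- environment exists for every context, so the argument covers open terms.
--
-- The same model supplies inversion of kinding without handling subsumption by hand: it shows which
-- constructors can have arrow kind and that an abstraction never has kind `Type`. This gives
-- progress for constructors (`HasKind.progress`), which progress for terms needs wherever a term
-- contains a constructor that may reduce.

/-- Kinds without the distinction between base kinds and their super-kinds. -/
inductive SKind : Type
  | ty | row
  | arr (k₁ k₂ : SKind)

/-- Closed values of the kinds `Type` (sort `con`) and `Row` (sort `row`). -/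
inductive Val : Srt → Type
  | bool : Val .con
  | int : Val .con
  | str : Val .con
  | list (v : Val .con) : Val .con
  | record (r : Val .row) : Val .con
  | trace (v : Val .con) : Val .con
  | nil : Val .row
  | cons (l : Label) (v : Val .con) (r : Val .row) : Val .row

/-- The interpretation of a kind as a set. -/
def SKind.El : SKind → Type
  | .ty => Val .con
  | .row => Val .row
  | .arr k₁ k₂ => k₁.El → k₂.El

/-- No kind is interpreted by the empty set. Environments therefore exist for all contexts, and a
statement about all values of a bound variable is never vacuous. -/
def SKind.default : (k : SKind) → k.El
  | .ty => Val.bool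
  | .row => Val.nil
  | .arr _ k₂ => fun _ => k₂.default

def SKind.srt : SKind → Srt
  | .row => .row
  | _ => .con

/-- Canonical forms only need types to be told apart by their outermost symbols, so the base kinds
can be forgotten; subsumption then has no effect in the model. -/
def Kind.erase : Kind → SKind
  | .type => .ty
  | .baseType => .ty
  | .row => .row
  | .baseRow => .row
  | .arr K₁ K₂ => .arr K₁.erase K₂.erase

theorem Kind.srt_erase (K : Kind) : K.erase.srt = K.srt := by cases K <;> rfl

theorem Subkind.erase_eq {K K' : Kind} (h : Subkind K K') : K.erase = K'.erase := by
  induction h with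
  | refl => rfl
  | baseType => rfl
  | baseRow => rfl
  | arr _ _ ih₁ ih₂ => simp [Kind.erase, ih₁, ih₂]

/-- The interpretation of `Rmap`; values of sort `con` are left alone. -/
def Val.map (f : Val .con → Val .con) : {s : Srt} → Val s → Val s
  | _, .nil => .nil
  | _, .cons l v r => .cons l (f v) (r.map f)
  | _, .bool => .bool
  | _, .int => .int
  | _, .str => .str
  | _, .list v => .list v
  | _, .record r => .record r
  | _, .trace v => .trace v

/-- Reads an element of any kind as a value of kind `Type`, arbitrarily if it is not one. -/
def SKind.toTy : (k : SKind) → k.El → Val .con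
  | .ty, v => v
  | _, _ => .bool

/-- The results of `Typerec` on values, and of its extension to rows of values. -/
def SKind.RecEl (k : SKind) : Srt → Type
  | .con => k.El
  | .row => Val .row

/-- The interpretation of `Typerec`. -/
def Val.typerec {k : SKind} (b i s : k.El) (fl : Val .con → k.El → k.El)
    (fr : Val .row → Val .row → k.El) (ft : Val .con → k.El → k.El) :
    {σ : Srt} → Val σ → k.RecEl σ
  | _, .bool => b
  | _, .int => i
  | _, .str => s
  | _, .list v => fl v (v.typerec b i s fl fr ft)
  | _, .record r => fr r (r.typerec b i s fl fr ft)
  | _, .trace v => ft v (v.typerec b i s fl fr ft)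
  | _, .nil => Val.nil
  | _, .cons l v r =>
      Val.cons l (k.toTy (v.typerec b i s fl fr ft)) (r.typerec b i s fl fr ft)

/-- The reduction rule for records distributes `Typerec` over the row by `Rmap`, whereas the model
recurses into the row directly. The two agree at result kind `Type`, where `SKind.toTy` is the
identity. -/
theorem Val.typerec_row (b i s : SKind.ty.El) (fl : Val .con → SKind.ty.El → SKind.ty.El)
    (fr : Val .row → Val .row → SKind.ty.El) (ft : Val .con → SKind.ty.El → SKind.ty.El) :
    (r : Val .row) →
      r.map (fun v => v.typerec (k := .ty) b i s fl fr ft)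
        = r.typerec (k := .ty) b i s fl fr ft
  | .nil => rfl
  | .cons l v r => by
      show Val.cons l _ (r.map _) = Val.cons l _ (r.typerec (k := .ty) b i s fl fr ft)
      rw [Val.typerec_row b i s fl fr ft r]; rfl

-- The denotation relation and its functionality

/-- Environments: kinds and values for the type and row variables. -/
abbrev Env : Type := List (Sigma SKind.El)

/-- `Den ρ C k v`: in the environment `ρ`, the constructor `C` has kind `k` and value `v`. -/
inductive Den : Env → {s : Srt} → Con s → (k : SKind) → k.El → Prop
  | var {ρ : Env} {s : Srt} {n : ℕ} {k : SKind} {v : k.El} :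
      ρ[n]? = some ⟨k, v⟩ → s = k.srt → Den ρ (.var s n) k v
  | bool {ρ} : Den ρ .bool .ty Val.bool
  | int {ρ} : Den ρ .int .ty Val.int
  | str {ρ} : Den ρ .str .ty Val.str
  -- The annotation fixes the domain, and the codomain kind `k` may not depend on the argument; `f`
  -- ranges over the full function space.
  | lam {ρ : Env} {K : Kind} {C : Con .con} {k : SKind} {f : K.erase.El → k.El} :
      (∀ v, Den (⟨K.erase, v⟩ :: ρ) C k (f v)) → Den ρ (.lam K C) (.arr K.erase k) f
  | app {ρ} {s : Srt} {C : Con .con} {D : Con s} {k₁ k₂ : SKind} {f : k₁.El → k₂.El}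
      {v : k₁.El} :
      Den ρ C (.arr k₁ k₂) f → s = k₁.srt → Den ρ D k₁ v → Den ρ (.app C D) k₂ (f v)
  | list {ρ} {C : Con .con} {v : Val .con} :
      Den ρ C .ty v → Den ρ (.list C) .ty (Val.list v)
  | record {ρ} {S : Con .row} {r : Val .row} :
      Den ρ S .row r → Den ρ (.record S) .ty (Val.record r)
  | trace {ρ} {C : Con .con} {v : Val .con} :
      Den ρ C .ty v → Den ρ (.trace C) .ty (Val.trace v)
  | typerec {ρ} {k : SKind} {C CB CI CS CL CR CT : Con .con} {v : Val .con} {b i s : k.El}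
      {fl : Val .con → k.El → k.El} {fr : Val .row → Val .row → k.El}
      {ft : Val .con → k.El → k.El} :
      Den ρ C .ty v → Den ρ CB k b → Den ρ CI k i → Den ρ CS k s →
      Den ρ CL (.arr .ty (.arr k k)) fl → Den ρ CR (.arr .row (.arr .row k)) fr →
      Den ρ CT (.arr .ty (.arr k k)) ft →
      Den ρ (.typerec C CB CI CS CL CR CT) k (v.typerec b i s fl fr ft)
  | nil {ρ} : Den ρ .nil .row Val.nil
  | cons {ρ} {l : Label} {C : Con .con} {S : Con .row} {v : Val .con} {r : Val .row} :
      Den ρ C .ty v → Den ρ S .row r → Den ρ (.cons l C S) .row (Val.cons l v r)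
  | rmap {ρ} {C : Con .con} {S : Con .row} {f : Val .con → Val .con} {r : Val .row} :
      Den ρ C (.arr .ty .ty) f → Den ρ S .row r → Den ρ (.rmap C S) .row (Val.map f r)

/-- Annotations on abstractions determine the erased kind as well as the value. Kind and value are
compared as a dependent pair because the two kinds are not known to coincide beforehand. -/
theorem Den.unique {ρ : Env} {s : Srt} {C : Con s} {k k' : SKind} {v : k.El} {v' : k'.El}
    (h : Den ρ C k v) (h' : Den ρ C k' v') : (⟨k, v⟩ : Sigma SKind.El) = ⟨k', v'⟩ := by
  induction h generalizing k' with
  | var e _ =>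
    cases h' with
    | var e' _ => exact Option.some.inj (e.symm.trans e')
  | bool => cases h'; rfl
  | int => cases h'; rfl
  | str => cases h'; rfl
  | nil => cases h'; rfl
  | @lam ρ K C k f h ih =>
    cases h' with
    | @lam _ _ _ k₂ f' h' =>
      have e := fun v => ih v (h' v)
      -- Some argument is needed to compare the codomain kinds; the default element provides it.
      obtain rfl : k = k₂ := congrArg Sigma.fst (e K.erase.default)
      have : f = f' := funext fun v => eq_of_heq (Sigma.mk.inj (e v)).2
      rw [this]
  | app _ _ _ ih₁ ih₂ =>
    cases h' with
    | app h₁ _ h₂ =>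
      have e₁ := ih₁ h₁
      have e₂ := ih₂ h₂
      cases e₂
      cases e₁
      rfl
  | list _ ih =>
    cases h' with
    | list h => cases ih h; rfl
  | record _ ih =>
    cases h' with
    | record h => cases ih h; rfl
  | trace _ ih =>
    cases h' with
    | trace h => cases ih h; rfl
  | typerec _ _ _ _ _ _ _ ih₀ ih₁ ih₂ ih₃ ih₄ ih₅ ih₆ =>
    cases h' with
    | typerec h₀ h₁ h₂ h₃ h₄ h₅ h₆ =>
      cases ih₀ h₀; cases ih₁ h₁; cases ih₂ h₂; cases ih₃ h₃; cases ih₄ h₄; cases ih₅ h₅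
      cases ih₆ h₆; rfl
  | cons _ _ ih₁ ih₂ =>
    cases h' with
    | cons h₁ h₂ => cases ih₁ h₁; cases ih₂ h₂; rfl
  | rmap _ _ ih₁ ih₂ =>
    cases h' with
    | rmap h₁ h₂ => cases ih₁ h₁; cases ih₂ h₂; rfl

/-- Inversion at a kind not yet known to be an arrow, for the places where that is exactly what has
to be discovered. -/
theorem Den.of_lam {ρ : Env} {K : Kind} {C : Con .con} {k : SKind} {f : k.El}
    (h : Den ρ (.lam K C) k f) :
    ∃ k', k = .arr K.erase k' ∧ ∀ v, ∃ w, Den (⟨K.erase, v⟩ :: ρ) C k' w := by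
  cases h with
  | lam h => exact ⟨_, rfl, fun v => ⟨_, h v⟩⟩

-- Renaming and substitution for denotations

theorem Den.ren {ρ : Env} {s : Srt} {C : Con s} {k : SKind} {v : k.El} (h : Den ρ C k v)
    {ρ' : Env} {ξ : ℕ → ℕ} (hξ : ∀ n x, ρ[n]? = some x → ρ'[ξ n]? = some x) :
    Den ρ' (C.ren ξ) k v := by
  induction h generalizing ρ' ξ with
  | var e hs => exact .var (hξ _ _ e) hs
  | bool => exact .bool
  | int => exact .int
  | str => exact .str
  | nil => exact .nil
  | lam _ ih =>
    refine .lam fun v => ih v fun n x e => ?_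
    cases n with
    | zero => exact e
    | succ n => exact hξ n x e
  | app _ hs _ ih₁ ih₂ => exact .app (ih₁ hξ) hs (ih₂ hξ)
  | list _ ih => exact .list (ih hξ)
  | record _ ih => exact .record (ih hξ)
  | trace _ ih => exact .trace (ih hξ)
  | typerec _ _ _ _ _ _ _ ih₀ ih₁ ih₂ ih₃ ih₄ ih₅ ih₆ =>
    exact .typerec (ih₀ hξ) (ih₁ hξ) (ih₂ hξ) (ih₃ hξ) (ih₄ hξ) (ih₅ hξ) (ih₆ hξ)
  | cons _ _ ih₁ ih₂ => exact .cons (ih₁ hξ) (ih₂ hξ)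
  | rmap _ _ ih₁ ih₂ => exact .rmap (ih₁ hξ) (ih₂ hξ)

theorem Den.wk {ρ : Env} {s : Srt} {C : Con s} {k : SKind} {v : k.El} (h : Den ρ C k v)
    (x : Sigma SKind.El) : Den (x :: ρ) C.wk k v :=
  h.ren fun _ _ e => e

/-- The substitution is constrained only at the sort that belongs to the kind of each variable, so
the value of `TSub.inst` at index `0` of the wrong sort is irrelevant. -/
theorem Den.subst {ρ : Env} {s : Srt} {C : Con s} {k : SKind} {v : k.El} (h : Den ρ C k v)
    {ρ' : Env} {σ : TSub}
    (hσ : ∀ n (x : Sigma SKind.El), ρ[n]? = some x → Den ρ' (σ x.1.srt n) x.1 x.2) :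
    Den ρ' (C.subst σ) k v := by
  induction h generalizing ρ' σ with
  | var e hs => subst hs; exact hσ _ _ e
  | bool => exact .bool
  | int => exact .int
  | str => exact .str
  | nil => exact .nil
  | lam _ ih =>
    refine .lam fun v => ih v fun n x e => ?_
    cases n with
    | zero => cases e; exact .var rfl rfl
    | succ n => exact (hσ n x e).wk _
  | app _ hs _ ih₁ ih₂ => exact .app (ih₁ hσ) hs (ih₂ hσ)
  | list _ ih => exact .list (ih hσ)
  | record _ ih => exact .record (ih hσ)
  | trace _ ih => exact .trace (ih hσ)
  | typerec _ _ _ _ _ _ _ ih₀ ih₁ ih₂ ih₃ ih₄ ih₅ ih₆ =>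
    exact .typerec (ih₀ hσ) (ih₁ hσ) (ih₂ hσ) (ih₃ hσ) (ih₄ hσ) (ih₅ hσ) (ih₆ hσ)
  | cons _ _ ih₁ ih₂ => exact .cons (ih₁ hσ) (ih₂ hσ)
  | rmap _ _ ih₁ ih₂ => exact .rmap (ih₁ hσ) (ih₂ hσ)

theorem Den.inst {ρ : Env} {s s' : Srt} {C : Con s} {D : Con s'} {k k' : SKind} {v : k.El}
    {v' : k'.El} (h : Den (⟨k', v'⟩ :: ρ) C k v) (hs : s' = k'.srt) (hD : Den ρ D k' v') :
    Den ρ (C.inst D) k v := by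
  refine h.subst fun n x e => ?_
  cases n with
  | zero => cases e; subst hs; simpa [TSub.inst] using hD
  | succ n => exact .var e rfl

-- Soundness of kinding, reduction and equivalence

/-- The environment `ρ` has the kinds `Δ`. -/
def Env.Models (ρ : Env) (Δ : List Kind) : Prop := ρ.map Sigma.fst = Δ.map Kind.erase

theorem Env.exists_models (Δ : List Kind) : ∃ ρ : Env, ρ.Models Δ :=
  ⟨Δ.map fun K => ⟨K.erase, K.erase.default⟩, by simp [Env.Models]⟩

theorem Env.Models.cons {ρ : Env} {Δ : List Kind} (h : ρ.Models Δ) (K : Kind)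
    (v : K.erase.El) : Env.Models (⟨K.erase, v⟩ :: ρ) (K :: Δ) := by
  simpa [Env.Models] using h

/-- Totality of the model. With `Den.unique` it lets the partial relation `Den` serve as an
interpretation function on well-kinded constructors. -/
theorem HasKind.exists_den {Δ : List Kind} {s : Srt} {C : Con s} {K : Kind}
    (h : HasKind Δ C K) {ρ : Env} (hρ : ρ.Models Δ) : ∃ v, Den ρ C K.erase v := by
  induction h generalizing ρ with
  | sub _ hs ih => rw [← hs.erase_eq]; exact ih hρ
  | bool => exact ⟨_, .bool⟩
  | int => exact ⟨_, .int⟩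
  | str => exact ⟨_, .str⟩
  | nil => exact ⟨_, .nil⟩
  | nilBase => exact ⟨_, .nil⟩
  | @var Δ s n K e hs =>
    have e' : (ρ.map Sigma.fst)[n]? = some K.erase := by
      rw [hρ, List.getElem?_map, e]; rfl
    rw [List.getElem?_map, Option.map_eq_some_iff] at e'
    obtain ⟨⟨k, v⟩, e', rfl⟩ := e'
    exact ⟨v, .var e' (hs.trans K.srt_erase.symm)⟩
  | @lam Δ K₁ K₂ C _ ih =>
    -- Choice turns a value of the body for each argument into one element of the full function
    -- space.
    choose f hf using fun v : K₁.erase.El => ih (hρ.cons K₁ v)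
    exact ⟨f, .lam hf⟩
  | @app Δ s K₁ K₂ C D _ hs _ ih₁ ih₂ =>
    obtain ⟨f, hf⟩ := ih₁ hρ
    obtain ⟨v, hv⟩ := ih₂ hρ
    exact ⟨_, .app hf (hs.trans K₁.srt_erase.symm) hv⟩
  | list _ ih => exact (ih hρ).elim fun v h => ⟨_, .list h⟩
  | record _ ih => exact (ih hρ).elim fun v h => ⟨_, .record h⟩
  | trace _ ih => exact (ih hρ).elim fun v h => ⟨_, .trace h⟩
  | typerec _ _ _ _ _ _ _ ih₀ ih₁ ih₂ ih₃ ih₄ ih₅ ih₆ =>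
    obtain ⟨_, h₀⟩ := ih₀ hρ
    obtain ⟨_, h₁⟩ := ih₁ hρ
    obtain ⟨_, h₂⟩ := ih₂ hρ
    obtain ⟨_, h₃⟩ := ih₃ hρ
    obtain ⟨_, h₄⟩ := ih₄ hρ
    obtain ⟨_, h₅⟩ := ih₅ hρ
    obtain ⟨_, h₆⟩ := ih₆ hρ
    exact ⟨_, .typerec h₀ h₁ h₂ h₃ h₄ h₅ h₆⟩
  | cons _ _ ih₁ ih₂ =>
    obtain ⟨_, h₁⟩ := ih₁ hρ
    obtain ⟨_, h₂⟩ := ih₂ hρ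
    exact ⟨_, .cons h₁ h₂⟩
  | consBase _ _ ih₁ ih₂ =>
    obtain ⟨_, h₁⟩ := ih₁ hρ
    obtain ⟨_, h₂⟩ := ih₂ hρ
    exact ⟨_, .cons h₁ h₂⟩
  | rmap _ _ ih₁ ih₂ =>
    obtain ⟨_, h₁⟩ := ih₁ hρ
    obtain ⟨_, h₂⟩ := ih₂ hρ
    exact ⟨_, .rmap h₁ h₂⟩

/-- Reduction preserves values as long as the reduct has one: a `Typerec` on a record can lose
its kind. -/
theorem Con.Red.den {s : Srt} {C C' : Con s} (hr : Con.Red C C') {ρ : Env} {k k' : SKind}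
    {v : k.El} {v' : k'.El} (h : Den ρ C k v) (h' : Den ρ C' k' v') :
    (⟨k, v⟩ : Sigma SKind.El) = ⟨k', v'⟩ := by
  induction hr generalizing ρ k k' with
  | consTail _ ih | consHead _ ih =>
    cases h with
    | cons h₁ h₂ =>
      cases h' with
      | cons h₁' h₂' =>
        first
          | cases h₁.unique h₁'; cases ih h₂ h₂'; rfl
          | cases ih h₁ h₁'; cases h₂.unique h₂'; rfl
  | appFun _ ih | appArg _ ih =>
    cases h with
    | app h₁ _ h₂ =>
      cases h' with
      | app h₁' _ h₂' =>
        first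
          | cases h₂.unique h₂'; cases ih h₁ h₁'; rfl
          | cases ih h₂ h₂'; cases h₁.unique h₁'; rfl
  | beta _ =>
    cases h with
    | app h₁ hs h₂ =>
      cases h₁ with
      -- The substitution lemma gives the reduct the value of the redex; uniqueness identifies it
      -- with the given one.
      | lam h₁ => exact ((h₁ _).inst hs h₂).unique h'
  | lam _ ih =>
    rename_i K _ _ _
    cases h with
    | @lam _ _ _ k f h =>
      cases h' with
      | @lam _ _ _ k₂ f' h' =>
        have e := fun v => ih (h v) (h' v)
        obtain rfl : k = k₂ := congrArg Sigma.fst (e K.erase.default)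
        have : f = f' := funext fun v => eq_of_heq (Sigma.mk.inj (e v)).2
        rw [this]
  | list _ ih => cases h with | list h => cases h' with | list h' => cases ih h h'; rfl
  | trace _ ih => cases h with | trace h => cases h' with | trace h' => cases ih h h'; rfl
  | record _ ih => cases h with | record h => cases h' with | record h' => cases ih h h'; rfl
  | rmapNil => cases h with | rmap _ h => cases h; cases h'; rfl
  | rmapCons =>
    cases h with
    | rmap h₁ h₂ =>
      cases h₂ with
      | cons h₂ h₃ => exact (Den.cons (.app h₁ rfl h₂) (.rmap h₁ h₃)).unique h'
  | rmapRow _ ih | rmapFun _ ih =>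
    cases h with
    | rmap h₁ h₂ =>
      cases h' with
      | rmap h₁' h₂' =>
        first
          | cases h₁.unique h₁'; cases ih h₂ h₂'; rfl
          | cases ih h₁ h₁'; cases h₂.unique h₂'; rfl
  | trScrut _ ih =>
    cases h with
    | typerec h₀ h₁ h₂ h₃ h₄ h₅ h₆ =>
      cases h' with
      | typerec h₀' h₁' h₂' h₃' h₄' h₅' h₆' =>
        cases ih h₀ h₀'; exact (Den.typerec h₀ h₁ h₂ h₃ h₄ h₅ h₆).unique
          (.typerec h₀ h₁' h₂' h₃' h₄' h₅' h₆')
  | trB _ ih =>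
    cases h with
    | typerec h₀ h₁ h₂ h₃ h₄ h₅ h₆ =>
      cases h' with
      | typerec h₀' h₁' h₂' h₃' h₄' h₅' h₆' =>
        cases ih h₁ h₁'; exact (Den.typerec h₀ h₁ h₂ h₃ h₄ h₅ h₆).unique
          (.typerec h₀' h₁ h₂' h₃' h₄' h₅' h₆')
  | trI _ ih =>
    cases h with
    | typerec h₀ h₁ h₂ h₃ h₄ h₅ h₆ =>
      cases h' with
      | typerec h₀' h₁' h₂' h₃' h₄' h₅' h₆' =>
        cases ih h₂ h₂'; exact (Den.typerec h₀ h₁ h₂ h₃ h₄ h₅ h₆).unique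
          (.typerec h₀' h₁' h₂ h₃' h₄' h₅' h₆')
  | trS _ ih =>
    cases h with
    | typerec h₀ h₁ h₂ h₃ h₄ h₅ h₆ =>
      cases h' with
      | typerec h₀' h₁' h₂' h₃' h₄' h₅' h₆' =>
        cases ih h₃ h₃'; exact (Den.typerec h₀ h₁ h₂ h₃ h₄ h₅ h₆).unique
          (.typerec h₀' h₁' h₂' h₃ h₄' h₅' h₆')
  | trL _ ih =>
    cases h with
    | typerec h₀ h₁ h₂ h₃ h₄ h₅ h₆ =>
      cases h' with
      | typerec h₀' h₁' h₂' h₃' h₄' h₅' h₆' =>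
        cases ih h₄ h₄'; exact (Den.typerec h₀ h₁ h₂ h₃ h₄ h₅ h₆).unique
          (.typerec h₀' h₁' h₂' h₃' h₄ h₅' h₆')
  | trR _ ih =>
    cases h with
    | typerec h₀ h₁ h₂ h₃ h₄ h₅ h₆ =>
      cases h' with
      | typerec h₀' h₁' h₂' h₃' h₄' h₅' h₆' =>
        cases ih h₅ h₅'; exact (Den.typerec h₀ h₁ h₂ h₃ h₄ h₅ h₆).unique
          (.typerec h₀' h₁' h₂' h₃' h₄' h₅ h₆')
  | trT _ ih =>
    cases h with
    | typerec h₀ h₁ h₂ h₃ h₄ h₅ h₆ =>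
      cases h' with
      | typerec h₀' h₁' h₂' h₃' h₄' h₅' h₆' =>
        cases ih h₆ h₆'; exact (Den.typerec h₀ h₁ h₂ h₃ h₄ h₅ h₆).unique
          (.typerec h₀' h₁' h₂' h₃' h₄' h₅' h₆)
  | trBool =>
    cases h with
    | typerec h₀ h₁ h₂ h₃ h₄ h₅ h₆ => cases h₀; exact h₁.unique h'
  | trInt =>
    cases h with
    | typerec h₀ h₁ h₂ h₃ h₄ h₅ h₆ => cases h₀; exact h₂.unique h'
  | trStr =>
    cases h with
    | typerec h₀ h₁ h₂ h₃ h₄ h₅ h₆ => cases h₀; exact h₃.unique h'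
  | trList =>
    cases h with
    | typerec h₀ h₁ h₂ h₃ h₄ h₅ h₆ =>
      cases h₀ with
      | list h₀ =>
        -- The reduct passes the recursive result, of sort `con`, as an argument. Its sort condition
        -- fails when `k` is the row kind, so it is taken from the denotation of the reduct.
        cases h' with
        | app hf hs hx =>
          have hx₀ := Den.typerec h₀ h₁ h₂ h₃ h₄ h₅ h₆
          cases hx₀.unique hx
          exact (Den.app (.app h₄ rfl h₀) hs hx₀).unique (.app hf hs hx)
  | trTrace =>
    cases h with
    | typerec h₀ h₁ h₂ h₃ h₄ h₅ h₆ =>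
      cases h₀ with
      | trace h₀ =>
        cases h' with
        | app hf hs hx =>
          have hx₀ := Den.typerec h₀ h₁ h₂ h₃ h₄ h₅ h₆
          cases hx₀.unique hx
          exact (Den.app (.app h₆ rfl h₀) hs hx₀).unique (.app hf hs hx)
  | trRecord =>
    cases h with
    | typerec h₀ h₁ h₂ h₃ h₄ h₅ h₆ =>
      cases h₀ with
      | record h₀ =>
        -- `Rmap` in the reduct forces the recursive call to return kind `Type`. Inspecting its body
        -- at an arbitrary value, here `Val.bool`, gives the weakened Boolean branch kind `Type`,
        -- and uniqueness transfers this to `k`.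
        have hk : k = .ty := by
          cases h' with
          | app _ _ hx =>
            cases hx with
            | rmap hx _ =>
              obtain ⟨k₀, hk₀, hx⟩ := hx.of_lam
              obtain ⟨-, rfl⟩ := SKind.arr.inj hk₀
              obtain ⟨w, hx⟩ := hx Val.bool
              cases hx with
              | typerec _ hB _ _ _ _ _ => exact congrArg Sigma.fst ((h₁.wk _).unique hB)
        subst hk
        -- With `k` equal to `Type` the value of the reduct can be built explicitly; what remains is
        -- that mapping over the row is recursion into the row.
        rw [← ((Den.app (.app h₅ rfl h₀) rfl (.rmap (.lam fun v =>
          .typerec (.var (v := v) rfl rfl) (h₁.wk _) (h₂.wk _) (h₃.wk _) (h₄.wk _) (h₅.wk _)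
            (h₆.wk _)) h₀)).unique h')]
        erw [Val.typerec_row]
        rfl

/-- Equivalent constructors have the same value. -/
theorem ConEq.exists_den {Δ : List Kind} {s : Srt} {C D : Con s} {K : Kind}
    (h : ConEq Δ C D K) {ρ : Env} (hρ : ρ.Models Δ) :
    ∃ v, Den ρ C K.erase v ∧ Den ρ D K.erase v := by
  induction h generalizing ρ with
  | refl h => exact (h.exists_den hρ).elim fun v h => ⟨v, h, h⟩
  | symm _ ih => exact (ih hρ).imp fun _ h => h.symm
  | trans _ _ ih₁ ih₂ =>
    obtain ⟨v, h₁, h₂⟩ := ih₁ hρ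
    obtain ⟨w, h₃, h₄⟩ := ih₂ hρ
    -- The middle constructor has one value only, which glues the two common values together.
    cases h₂.unique h₃
    exact ⟨v, h₁, h₄⟩
  | sub _ hs ih => rw [← hs.erase_eq]; exact ih hρ
  | @eta Δ C K K' h =>
    obtain ⟨f, hf⟩ := h.exists_den hρ
    -- In a full function space η holds definitionally.
    exact ⟨f, .lam fun v => .app (hf.wk _) K.srt_erase.symm
      (.var (v := v) rfl K.srt_erase.symm), hf⟩
  | @lam Δ C D K K' _ ih =>
    choose f hf hf' using fun v : K.erase.El => ih (hρ.cons K v)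
    exact ⟨f, .lam hf, .lam hf'⟩
  | @app Δ s C C' D D' K K' _ hs _ ih₁ ih₂ =>
    obtain ⟨f, h₁, h₁'⟩ := ih₁ hρ
    obtain ⟨v, h₂, h₂'⟩ := ih₂ hρ
    have hs := hs.trans K'.srt_erase.symm
    exact ⟨_, .app h₁ hs h₂, .app h₁' hs h₂'⟩
  | list _ ih => exact (ih hρ).elim fun v h => ⟨_, .list h.1, .list h.2⟩
  | record _ ih => exact (ih hρ).elim fun v h => ⟨_, .record h.1, .record h.2⟩
  | trace _ ih => exact (ih hρ).elim fun v h => ⟨_, .trace h.1, .trace h.2⟩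
  | red h h' hr =>
    -- Both sides of a reduction in an equivalence are well-kinded, which excludes the reducts that
    -- lose their kind.
    obtain ⟨v, h⟩ := h.exists_den hρ
    obtain ⟨v', h'⟩ := h'.exists_den hρ
    cases hr.den h h'
    exact ⟨v, h, h'⟩
  | nil => exact ⟨_, .nil, .nil⟩
  | cons _ _ ih₁ ih₂ | consBase _ _ ih₁ ih₂ =>
    obtain ⟨v, h₁, h₁'⟩ := ih₁ hρ
    obtain ⟨r, h₂, h₂'⟩ := ih₂ hρ
    exact ⟨_, .cons h₁ h₂, .cons h₁' h₂'⟩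
  | rmap _ _ ih₁ ih₂ =>
    obtain ⟨v, h₁, h₁'⟩ := ih₁ hρ
    obtain ⟨r, h₂, h₂'⟩ := ih₂ hρ
    exact ⟨_, .rmap h₁ h₂, .rmap h₁' h₂'⟩
  | typerec _ _ _ _ _ _ _ ih₀ ih₁ ih₂ ih₃ ih₄ ih₅ ih₆ =>
    obtain ⟨_, h₀, h₀'⟩ := ih₀ hρ
    obtain ⟨_, h₁, h₁'⟩ := ih₁ hρ
    obtain ⟨_, h₂, h₂'⟩ := ih₂ hρ
    obtain ⟨_, h₃, h₃'⟩ := ih₃ hρ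
    obtain ⟨_, h₄, h₄'⟩ := ih₄ hρ
    obtain ⟨_, h₅, h₅'⟩ := ih₅ hρ
    obtain ⟨_, h₆, h₆'⟩ := ih₆ hρ
    exact ⟨_, .typerec h₀ h₁ h₂ h₃ h₄ h₅ h₆, .typerec h₀' h₁' h₂' h₃' h₄' h₅' h₆'⟩

/-! ### Consistency of type equivalence -/

/-- Outermost constructors of types and row types. -/
inductive Head : Type
  | bool | int | str | fn | list | trace | nil
  -- A record remembers the head of its row: projection has to distinguish the empty row from an
  -- extension and compare first labels.
  | record (h : Head)
  | all (K : Kind)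
  | cons (l : Label)

def Val.head : {s : Srt} → Val s → Head
  | _, .bool => .bool
  | _, .int => .int
  | _, .str => .str
  | _, .list _ => .list
  | _, .record r => .record r.head
  | _, .trace _ => .trace
  | _, .nil => .nil
  | _, .cons l _ _ => .cons l

/-- `HeadOf ρ A h`: in the environment `ρ`, the type or row type `A` computes to one with
outermost constructor `h`. -/
inductive HeadOf (ρ : Env) : {s : Srt} → Ty s → Head → Prop
  | T {C : Con .con} {v : Val .con} : Den ρ C .ty v → HeadOf ρ (.T C) v.head
  | TRow {S : Con .row} {r : Val .row} : Den ρ S .row r → HeadOf ρ (.T S) r.head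
  | bool : HeadOf ρ .bool .bool
  | int : HeadOf ρ .int .int
  | str : HeadOf ρ .str .str
  | fn {A B : Ty .con} : HeadOf ρ (.fn A B) .fn
  | list {A : Ty .con} : HeadOf ρ (.list A) .list
  | record {R : Ty .row} {h : Head} : HeadOf ρ R h → HeadOf ρ (.record R) (.record h)
  | trace {A : Ty .con} : HeadOf ρ (.trace A) .trace
  | all {K : Kind} {A : Ty .con} : HeadOf ρ (.all K A) (.all K)
  | nil : HeadOf ρ .nil .nil
  | cons {l : Label} {A : Ty .con} {R : Ty .row} : HeadOf ρ (.cons l A R) (.cons l)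

theorem HeadOf.unique {ρ : Env} {s : Srt} {A : Ty s} {h h' : Head} (H : HeadOf ρ A h)
    (H' : HeadOf ρ A h') : h = h' := by
  induction H generalizing h' with
  | T d => cases H' with | T d' => cases d.unique d'; rfl
  | TRow d => cases H' with | TRow d' => cases d.unique d'; rfl
  | record _ ih => cases H' with | record H' => rw [ih H']
  | _ => cases H'; rfl

theorem TyKind.exists_head {Δ : List Kind} {s : Srt} {A : Ty s} {K : Kind}
    (h : TyKind Δ A K) {ρ : Env} (hρ : ρ.Models Δ) : ∃ h, HeadOf ρ A h := by
  induction h generalizing ρ with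
  | sub _ _ ih => exact ih hρ
  | T h | TBase h => exact (h.exists_den hρ).elim fun v d => ⟨_, .T d⟩
  | TRow h | TBaseRow h => exact (h.exists_den hρ).elim fun v d => ⟨_, .TRow d⟩
  | bool => exact ⟨_, .bool⟩
  | int => exact ⟨_, .int⟩
  | str => exact ⟨_, .str⟩
  | all => exact ⟨_, .all⟩
  | fn => exact ⟨_, .fn⟩
  | list => exact ⟨_, .list⟩
  | record _ ih => exact (ih hρ).elim fun _ h => ⟨_, .record h⟩
  | trace => exact ⟨_, .trace⟩
  | nil | nilBase => exact ⟨_, .nil⟩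
  | cons | consBase => exact ⟨_, .cons⟩

/-- Moving `T` inwards exposes the symbol already at the head of the value, so each rule preserves
heads. Only records inspect a component; in particular nothing has to be checked below a quantifier.
-/
theorem TyEq.exists_head {Δ : List Kind} {s : Srt} {A B : Ty s} {K : Kind}
    (h : TyEq Δ A B K) {ρ : Env} (hρ : ρ.Models Δ) :
    ∃ h, HeadOf ρ A h ∧ HeadOf ρ B h := by
  induction h generalizing ρ with
  | refl h => exact (h.exists_head hρ).imp fun _ h => ⟨h, h⟩
  | symm _ ih => exact (ih hρ).imp fun _ h => h.symm
  | trans _ _ ih₁ ih₂ =>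
    obtain ⟨h, h₁, h₂⟩ := ih₁ hρ
    obtain ⟨h', h₃, h₄⟩ := ih₂ hρ
    cases h₂.unique h₃
    exact ⟨h, h₁, h₄⟩
  | sub _ _ ih => exact ih hρ
  | TBool => exact ⟨_, .T .bool, .bool⟩
  | TInt => exact ⟨_, .T .int, .int⟩
  | TStr => exact ⟨_, .T .str, .str⟩
  | TList h => exact (h.exists_den hρ).elim fun _ d => ⟨_, .T (.list d), .list⟩
  | TRecord h =>
    exact (h.exists_den hρ).elim fun _ d => ⟨_, .T (.record d), .record (.TRow d)⟩
  | TTrace h => exact (h.exists_den hρ).elim fun _ d => ⟨_, .T (.trace d), .trace⟩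
  | TNil => exact ⟨_, .TRow .nil, .nil⟩
  | TCons h h' =>
    obtain ⟨_, d⟩ := h.exists_den hρ
    obtain ⟨_, d'⟩ := h'.exists_den hρ
    exact ⟨_, .TRow (.cons d d'), .cons⟩
  | T h | TBase h => exact (h.exists_den hρ).elim fun _ d => ⟨_, .T d.1, .T d.2⟩
  | TRow h | TBaseRow h => exact (h.exists_den hρ).elim fun _ d => ⟨_, .TRow d.1, .TRow d.2⟩
  | list => exact ⟨_, .list, .list⟩
  | record _ ih => exact (ih hρ).elim fun _ h => ⟨_, .record h.1, .record h.2⟩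
  | trace => exact ⟨_, .trace, .trace⟩
  | fn => exact ⟨_, .fn, .fn⟩
  | all => exact ⟨_, .all, .all⟩
  | nil => exact ⟨_, .nil, .nil⟩
  | cons | consBase => exact ⟨_, .cons, .cons⟩

-- Visible shapes and consistency

/-- Head symbols of types without those of rows. -/
inductive Shape : Type
  | bool | int | str | fn | list | trace | record
  | all (K : Kind)

def Head.shape : Head → Option Shape
  | .bool => some .bool
  | .int => some .int
  | .str => some .str
  | .fn => some .fn
  | .list => some .list
  | .trace => some .trace
  | .record _ => some .record
  | .all K => some (.all K)
  | _ => none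

/-- The shape of a type, as far as it shows without computation. -/
def Ty.shape : Ty .con → Option Shape
  -- The rule for `rmap` produces a type of this form, which must count as a record before any
  -- conversion.
  | .T (.record _) => some .record
  | .T _ => none
  | .bool => some .bool
  | .int => some .int
  | .str => some .str
  | .fn _ _ => some .fn
  | .list _ => some .list
  | .record _ => some .record
  | .trace _ => some .trace
  | .all K _ => some (.all K)

theorem HeadOf.shape_eq {ρ : Env} {A : Ty .con} {h : Head} (H : HeadOf ρ A h) {t : Shape}
    (ht : A.shape = some t) : h.shape = some t := by
  cases H with
  | T d =>
    cases d with
    | record d => exact ht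
    | _ => cases ht
  | _ => exact ht

/-- Equality of types as far as the conversion rule sees it. -/
def Conv (Δ : List Kind) (A B : Ty .con) : Prop := A = B ∨ TyEq Δ A B .type

/-- Literal equality is a separate alternative in `Conv` because reflexivity of equivalence requires
a well-kinded type, and typing does not guarantee one in a context that need not be well formed. -/
theorem Conv.trans {Δ : List Kind} {A B C : Ty .con} (h : TyEq Δ A B .type)
    (h' : Conv Δ B C) : Conv Δ A C := by
  rcases h' with rfl | h'
  exacts [.inr h, .inr (h.trans h')]

/-- Consistency: in any environment for `Δ` both types have the same head, and a visible shape is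
the shape of that head. -/
theorem Conv.shape_eq {Δ : List Kind} {A B : Ty .con} (h : Conv Δ A B) {t t' : Shape}
    (ht : A.shape = some t) (ht' : B.shape = some t') : t = t' := by
  rcases h with rfl | h
  · exact Option.some.inj (ht.symm.trans ht')
  · obtain ⟨ρ, hρ⟩ := Env.exists_models Δ
    obtain ⟨h, h₁, h₂⟩ := h.exists_head hρ
    exact Option.some.inj ((h₁.shape_eq ht).symm.trans (h₂.shape_eq ht'))

/-! ### Canonical forms -/

def Const.shape : Const → Shape
  | .bool _ => .bool
  | .int _ => .int
  | .str _ => .str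

/-- The shape of the type of an introduction form. -/
def Tm.shape : Tm → Option Shape
  | .const c => some c.shape
  | .lam _ _ => some .fn
  | .tlam K _ => some (.all K)
  | .plus _ _ => some .int
  | .eq _ _ => some .bool
  | .unit => some .record
  | .ext _ _ _ => some .record
  | .rmap _ _ _ => some .record
  | .nil => some .list
  | .single _ => some .list
  | .append _ _ => some .list
  | .for _ _ => some .list
  | .table _ _ => some .list
  | .trLit _ => some .trace
  | .trIf _ => some .trace
  | .trFor _ _ => some .trace
  | .trCell _ => some .trace
  | .trOpEq _ _ => some .trace
  | .trOpPlus _ => some .trace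
  | _ => none

/-- Conversion is the only typing rule not directed by the term, so a derivation is one
syntax-directed step followed by conversions, which are collected here. -/
theorem HasType.exists_conv {Δ : List Kind} {Γ : List (Ty .con)} {M : Tm} {A : Ty .con}
    (h : HasType Δ Γ M A) {t : Shape} (ht : M.shape = some t) :
    ∃ B, B.shape = some t ∧ Conv Δ A B := by
  induction h with
  | conv _ hAB ih => exact (ih ht).imp fun B hB => ⟨hB.1, hB.2.trans hAB⟩
  | @const _ _ c => cases c <;> exact ⟨_, by exact ht, .inl rfl⟩
  | _ => first | cases ht; done | exact ⟨_, by exact ht, .inl rfl⟩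

/-- The canonical-forms tool. An elimination rule fixes the shape of the type and a normal form the
shape of the term; a mismatch is absurd, and for type abstractions a match equates the two kinds. -/
theorem HasType.shape_eq {Δ : List Kind} {Γ : List (Ty .con)} {M : Tm} {A : Ty .con}
    (h : HasType Δ Γ M A) {t t' : Shape} (ht : M.shape = some t) (ht' : A.shape = some t') :
    t' = t := by
  obtain ⟨B, hB, hAB⟩ := h.exists_conv ht
  exact hAB.shape_eq ht' hB

-- Canonical forms of records

theorem HasType.unit_conv {Δ : List Kind} {Γ : List (Ty .con)} {A : Ty .con}
    (h : HasType Δ Γ .unit A) : Conv Δ A (.record .nil) := by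
  generalize hM : Tm.unit = M at h
  induction h with
  | conv _ hAB ih => exact .trans hAB (ih hM)
  | unit => exact .inl rfl
  | _ => cases hM

theorem HasType.ext_conv {Δ : List Kind} {Γ : List (Ty .con)} {A : Ty .con} {l : Label}
    {M N : Tm} (h : HasType Δ Γ (.ext l M N) A) : ∃ B R, Conv Δ A (.record (.cons l B R)) := by
  generalize hM : Tm.ext l M N = L at h
  induction h with
  | conv _ hAB ih =>
    obtain ⟨B, R, h⟩ := ih hM
    exact ⟨B, R, .trans hAB h⟩
  | ext => cases hM; exact ⟨_, _, .inl rfl⟩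
  | _ => cases hM

/-- Shapes forget the row, so record types are compared through their heads in some environment. -/
theorem Conv.record_head {Δ : List Kind} {R R' : Ty .row}
    (h : Conv Δ (.record R) (.record R')) :
    R = R' ∨ ∃ (ρ : Env) (h : Head), HeadOf ρ R h ∧ HeadOf ρ R' h := by
  rcases h with h | h
  · exact .inl (Ty.record.inj h)
  · obtain ⟨ρ, hρ⟩ := Env.exists_models Δ
    obtain ⟨_, h₁, h₂⟩ := h.exists_head hρ
    cases h₁ with
    | record h₁ => cases h₂ with | record h₂ => exact .inr ⟨ρ, _, h₁, h₂⟩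

theorem HasType.not_unit_cons {Δ : List Kind} {Γ : List (Ty .con)} {l : Label} {A : Ty .con}
    {R : Ty .row} : ¬ HasType Δ Γ .unit (.record (.cons l A R)) := by
  intro h
  rcases h.unit_conv.record_head with h | ⟨ρ, _, h₁, h₂⟩
  · cases h
  · cases h₁; cases h₂

/-- Rows cannot be reordered, so the first label is part of the head and survives equivalence. -/
theorem HasType.ext_label {Δ : List Kind} {Γ : List (Ty .con)} {k l : Label} {A : Ty .con}
    {R : Ty .row} {M N : Tm} (h : HasType Δ Γ (.ext k M N) (.record (.cons l A R))) : k = l := by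
  obtain ⟨B, R', h⟩ := h.ext_conv
  rcases h.record_head with h | ⟨ρ, _, h₁, h₂⟩
  · cases h; rfl
  · cases h₁; cases h₂; rfl

/-! ### Progress for constructors -/

/-- In the model an abstraction denotes only at arrow kinds, whatever subsumption was used. -/
theorem HasKind.not_lam_type {Δ : List Kind} {K : Kind} {C : Con .con} :
    ¬ HasKind Δ (.lam K C) .type := by
  intro h
  obtain ⟨ρ, hρ⟩ := Env.exists_models Δ
  obtain ⟨v, d⟩ := h.exists_den hρ
  obtain ⟨_, hk, -⟩ := d.of_lam
  cases hk

/-- A normal constructor of arrow kind is neutral or an abstraction. -/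
theorem NormalC.neutral_or_lam {Δ : List Kind} {C : Con .con} {K₁ K₂ : Kind} (hC : NormalC C)
    (h : HasKind Δ C (.arr K₁ K₂)) :
    NeutralC C ∨ ∃ K' D, C = .lam K' D ∧ K'.srt = K₁.srt := by
  obtain ⟨ρ, hρ⟩ := Env.exists_models Δ
  obtain ⟨v, d⟩ := h.exists_den hρ
  cases hC with
  | neutral h => exact .inl h
  | @lam K' D _ =>
    obtain ⟨k, hk, -⟩ := d.of_lam
    -- The annotation agrees with `K₁` only up to erasure. That determines the sort, which is all
    -- the β-rule checks.
    exact .inr ⟨K', D, rfl, by rw [← K₁.srt_erase, (SKind.arr.inj hk).1, K'.srt_erase]⟩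
  | _ => cases d

/-- A normal row is a list of components ending in `·` or in a neutral tail: the first case triggers
the rules for `rmap` and `rfold`, the second makes them stuck. The sort is a variable with an
equation so that induction on the indexed family applies. -/
theorem NormalR.eq_rowOf_or_neutral {s : Srt} {S : Con s} :
    (hs : s = .row) → NormalR (hs ▸ S) → (∃ fs, (hs ▸ S) = rowOf fs) ∨ NeutralR (hs ▸ S) := by
  induction S with
  | nil => exact fun _ _ => .inl ⟨[], rfl⟩
  | cons l C S _ ih =>
    intro _ h
    cases h with
    | cons hC hS =>
      rcases ih rfl hS with ⟨fs, h⟩ | h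
      · exact .inl ⟨(l, C) :: fs, congrArg (Con.cons l C) h⟩
      · exact .inr (.cons hC h)
    | neutral h => exact .inr h
  | var s n => rintro rfl h; cases h with | neutral h => exact .inr h
  | rmap => intro _ h; cases h with | neutral h => exact .inr h
  | _ => intro hs; cases hs

/-- Normality of constructors and row constructors. -/
def Con.Normal : {s : Srt} → Con s → Prop
  | .con, C => NormalC C
  | .row, S => NormalR S

/-- Progress for constructors and row constructors. -/
theorem HasKind.progress {Δ : List Kind} {s : Srt} {C : Con s} {K : Kind}
    (h : HasKind Δ C K) : C.Normal ∨ ∃ C', Con.Red C C' := by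
  induction h with
  | sub _ _ ih => exact ih
  | bool => exact .inl .bool
  | int => exact .inl .int
  | str => exact .inl .str
  | @var _ s =>
    cases s
    exacts [.inl (.neutral .var), .inl (.neutral .var)]
  | lam _ ih =>
    rcases ih with h | ⟨_, h⟩
    exacts [.inl (.lam h), .inr ⟨_, .lam h⟩]
  | @app Δ s K₁ K₂ C D hC hs _ ih₁ ih₂ =>
    rcases ih₁ with h₁ | ⟨_, h⟩
    swap; · exact .inr ⟨_, .appFun h⟩
    rcases ih₂ with h₂ | ⟨_, h⟩
    swap; · exact .inr ⟨_, .appArg h⟩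
    rcases NormalC.neutral_or_lam h₁ hC with h | ⟨K', D, rfl, hK⟩
    · cases s
      exacts [.inl (.neutral (.appC h h₂)), .inl (.neutral (.appR h h₂))]
    · exact .inr ⟨_, .beta (hs.trans hK.symm)⟩
  | list _ ih =>
    rcases ih with h | ⟨_, h⟩
    exacts [.inl (.list h), .inr ⟨_, .list h⟩]
  | record _ ih =>
    rcases ih with h | ⟨_, h⟩
    exacts [.inl (.record h), .inr ⟨_, .record h⟩]
  | trace _ ih =>
    rcases ih with h | ⟨_, h⟩
    exacts [.inl (.trace h), .inr ⟨_, .trace h⟩]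
  | @typerec Δ _ _ _ _ _ _ _ _ hC _ _ _ _ _ _ ih₀ ih₁ ih₂ ih₃ ih₄ ih₅ ih₆ =>
    rcases ih₀ with h₀ | ⟨_, h⟩
    swap; · exact .inr ⟨_, .trScrut h⟩
    rcases ih₁ with h₁ | ⟨_, h⟩
    swap; · exact .inr ⟨_, .trB h⟩
    rcases ih₂ with h₂ | ⟨_, h⟩
    swap; · exact .inr ⟨_, .trI h⟩
    rcases ih₃ with h₃ | ⟨_, h⟩
    swap; · exact .inr ⟨_, .trS h⟩
    rcases ih₄ with h₄ | ⟨_, h⟩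
    swap; · exact .inr ⟨_, .trL h⟩
    rcases ih₅ with h₅ | ⟨_, h⟩
    swap; · exact .inr ⟨_, .trR h⟩
    rcases ih₆ with h₆ | ⟨_, h⟩
    swap; · exact .inr ⟨_, .trT h⟩
    -- Each normal scrutinee is neutral, selects a `Typerec` rule, or is an abstraction, which
    -- cannot have kind `Type`.
    cases h₀ with
    | neutral h => exact .inl (.neutral (.typerec h h₁ h₂ h₃ h₄ h₅ h₆))
    | bool => exact .inr ⟨_, .trBool⟩
    | int => exact .inr ⟨_, .trInt⟩
    | str => exact .inr ⟨_, .trStr⟩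
    | list => exact .inr ⟨_, .trList⟩
    | record => exact .inr ⟨_, .trRecord⟩
    | trace => exact .inr ⟨_, .trTrace⟩
    | lam => exact (HasKind.not_lam_type hC).elim
  | nil | nilBase => exact .inl .nil
  | cons _ _ ih₁ ih₂ | consBase _ _ ih₁ ih₂ =>
    rcases ih₁ with h₁ | ⟨_, h⟩
    swap; · exact .inr ⟨_, .consHead h⟩
    rcases ih₂ with h₂ | ⟨_, h⟩
    swap; · exact .inr ⟨_, .consTail h⟩
    exact .inl (.cons h₁ h₂)
  | rmap _ _ ih₁ ih₂ =>
    rcases ih₁ with h₁ | ⟨_, h⟩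
    swap; · exact .inr ⟨_, .rmapFun h⟩
    rcases ih₂ with h₂ | ⟨_, h⟩
    swap; · exact .inr ⟨_, .rmapRow h⟩
    cases h₂ with
    | nil => exact .inr ⟨_, .rmapNil⟩
    | cons => exact .inr ⟨_, .rmapCons⟩
    | neutral h => exact .inl (.neutral (.rmap h₁ h))

/-! ### Progress for terms -/

/-- Reduction also acts under binders and in branches, so every premise that types a reducible
immediate subterm supplies an induction hypothesis in its own, possibly extended, context. Only with
these subterms normal does canonical forms decide between a redex and a normal form. -/
theorem HasType.progress {Δ : List Kind} {Γ : List (Ty .con)} {M : Tm} {A : Ty .con}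
    (h : HasType Δ Γ M A) : Normal M ∨ ∃ M', Tm.Red M M' := by
  induction h with
  | const => exact .inl .const
  | var => exact .inl (.neutral .var)
  | lam _ _ ih =>
    rcases ih with h | ⟨_, h⟩
    exacts [.inl (.lam h), .inr ⟨_, .lam h⟩]
  | app hM _ ih₁ ih₂ =>
    rcases ih₁ with h₁ | ⟨_, h⟩
    swap; · exact .inr ⟨_, .app₁ h⟩
    rcases ih₂ with h₂ | ⟨_, h⟩
    swap; · exact .inr ⟨_, .app₂ h⟩
    cases h₁ with
    | neutral h => exact .inl (.neutral (.app h h₂))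
    | lam => exact .inr ⟨_, .beta⟩
    | ite => exact .inr ⟨_, .ccApp⟩
    | @const c => cases c <;> cases hM.shape_eq rfl rfl
    | _ => cases hM.shape_eq rfl rfl
  | tlam _ ih =>
    rcases ih with h | ⟨_, h⟩
    exacts [.inl (.tlam h), .inr ⟨_, .tlam h⟩]
  | @tapp _ _ s _ _ _ _ hM hs hC ih =>
    rcases ih with h₁ | ⟨_, h⟩
    swap; · exact .inr ⟨_, .tapp₁ h⟩
    rcases hC.progress with h₂ | ⟨_, h⟩
    swap; · exact .inr ⟨_, .tapp₂ h⟩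
    cases h₁ with
    | neutral h =>
      cases s
      exacts [.inl (.neutral (.tappC h h₂)), .inl (.neutral (.tappR h h₂))]
    -- The shape of a quantified type contains its kind, so the annotation equals the kind in the
    -- typing rule and the sort condition carries over.
    | tlam => cases hM.shape_eq rfl rfl; exact .inr ⟨_, .tbeta hs⟩
    | ite => exact .inr ⟨_, .ccTapp⟩
    | @const c => cases c <;> cases hM.shape_eq rfl rfl
    | _ => cases hM.shape_eq rfl rfl
  -- A fixpoint is always a redex.
  | fix => exact .inr ⟨_, .fix⟩
  | ite hL _ _ ih₁ ih₂ ih₃ =>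
    rcases ih₁ with h₁ | ⟨_, h⟩
    swap; · exact .inr ⟨_, .ite₁ h⟩
    rcases ih₂ with h₂ | ⟨_, h⟩
    swap; · exact .inr ⟨_, .ite₂ h⟩
    rcases ih₃ with h₃ | ⟨_, h⟩
    swap; · exact .inr ⟨_, .ite₃ h⟩
    cases h₁ with
    | neutral h => exact .inl (.ite (.neutral h) h₂ h₃)
    -- An equality test never computes, so it remains as a neutral conditional.
    | eq h h' => exact .inl (.ite (.eq h h') h₂ h₃)
    | ite => exact .inr ⟨_, .ccIte⟩
    | @const c =>
      cases c with
      | bool b =>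
        cases b
        exacts [.inr ⟨_, .iteFalse⟩, .inr ⟨_, .iteTrue⟩]
      | _ => cases hL.shape_eq rfl rfl
    | _ => cases hL.shape_eq rfl rfl
  | plus _ _ ih₁ ih₂ =>
    rcases ih₁ with h₁ | ⟨_, h⟩
    swap; · exact .inr ⟨_, .plus₁ h⟩
    rcases ih₂ with h₂ | ⟨_, h⟩
    exacts [.inl (.plus h₁ h₂), .inr ⟨_, .plus₂ h⟩]
  | eq _ _ _ ih₁ ih₂ =>
    rcases ih₁ with h₁ | ⟨_, h⟩
    swap; · exact .inr ⟨_, .eq₁ h⟩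
    rcases ih₂ with h₂ | ⟨_, h⟩
    exacts [.inl (.eq h₁ h₂), .inr ⟨_, .eq₂ h⟩]
  | table => exact .inl .table
  | nil => exact .inl .nil
  | single _ ih =>
    rcases ih with h | ⟨_, h⟩
    exacts [.inl (.single h), .inr ⟨_, .single h⟩]
  | append _ _ ih₁ ih₂ =>
    rcases ih₁ with h₁ | ⟨_, h⟩
    swap; · exact .inr ⟨_, .append₁ h⟩
    rcases ih₂ with h₂ | ⟨_, h⟩
    exacts [.inl (.append h₁ h₂), .inr ⟨_, .append₂ h⟩]
  | unit => exact .inl .unit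
  | ext _ _ ih₁ ih₂ =>
    rcases ih₁ with h₁ | ⟨_, h⟩
    swap; · exact .inr ⟨_, .ext₁ h⟩
    rcases ih₂ with h₂ | ⟨_, h⟩
    exacts [.inl (.ext h₁ h₂), .inr ⟨_, .ext₂ h⟩]
  | proj hM ih =>
    rcases ih with h₁ | ⟨_, h⟩
    swap; · exact .inr ⟨_, .proj h⟩
    cases h₁ with
    | neutral h => exact .inl (.neutral (.proj (.neutral h)))
    | rmap hU h h' => exact .inl (.neutral (.proj (.rmap hU h h')))
    | ite => exact .inr ⟨_, .ccProj⟩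
    | unit => exact (HasType.not_unit_cons hM).elim
    -- The typing rule projects the first label of the row, so the component sought is the outermost
    -- one.
    | ext => cases hM.ext_label; exact .inr ⟨_, .projExt .here⟩
    | @const c => cases c <;> cases hM.shape_eq rfl rfl
    | _ => cases hM.shape_eq rfl rfl
  | conv _ _ ih => exact ih
  | rmap hS _ _ ih₁ ih₂ =>
    rcases hS.progress with h₀ | ⟨_, h⟩
    swap; · exact .inr ⟨_, .rmap₁ h⟩
    rcases ih₁ with h₁ | ⟨_, h⟩
    swap; · exact .inr ⟨_, .rmap₂ h⟩
    rcases ih₂ with h₂ | ⟨_, h⟩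
    swap; · exact .inr ⟨_, .rmap₃ h⟩
    rcases NormalR.eq_rowOf_or_neutral rfl h₀ with ⟨fs, rfl⟩ | h
    exacts [.inr ⟨_, .rmapClosed⟩, .inl (.rmap h h₁ h₂)]
  | rfold hS _ _ _ ih₁ ih₂ ih₃ =>
    rcases hS.progress with h₀ | ⟨_, h⟩
    swap; · exact .inr ⟨_, .rfold₁ h⟩
    rcases ih₁ with h₁ | ⟨_, h⟩
    swap; · exact .inr ⟨_, .rfold₂ h⟩
    rcases ih₂ with h₂ | ⟨_, h⟩
    swap; · exact .inr ⟨_, .rfold₃ h⟩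
    rcases ih₃ with h₃ | ⟨_, h⟩
    swap; · exact .inr ⟨_, .rfold₄ h⟩
    rcases NormalR.eq_rowOf_or_neutral rfl h₀ with ⟨fs, rfl⟩ | h
    exacts [.inr ⟨_, .rfoldClosed⟩, .inl (.neutral (.rfold h h₁ h₂ h₃))]
  | @typecase Δ _ _ _ _ _ _ _ _ _ hC _ _ _ _ _ _ _ ih₁ ih₂ ih₃ ih₄ ih₅ ih₆ =>
    rcases hC.progress with h₀ | ⟨_, h⟩
    swap; · exact .inr ⟨_, .tyScrut h⟩
    rcases ih₁ with h₁ | ⟨_, h⟩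
    swap; · exact .inr ⟨_, .tyB h⟩
    rcases ih₂ with h₂ | ⟨_, h⟩
    swap; · exact .inr ⟨_, .tyI h⟩
    rcases ih₃ with h₃ | ⟨_, h⟩
    swap; · exact .inr ⟨_, .tyS h⟩
    rcases ih₄ with h₄ | ⟨_, h⟩
    swap; · exact .inr ⟨_, .tyL h⟩
    rcases ih₅ with h₅ | ⟨_, h⟩
    swap; · exact .inr ⟨_, .tyR h⟩
    rcases ih₆ with h₆ | ⟨_, h⟩
    swap; · exact .inr ⟨_, .tyT h⟩
    cases h₀ with
    | neutral h => exact .inl (.neutral (.typecase h h₁ h₂ h₃ h₄ h₅ h₆))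
    | bool => exact .inr ⟨_, .tyBool⟩
    | int => exact .inr ⟨_, .tyInt⟩
    | str => exact .inr ⟨_, .tyStr⟩
    | list => exact .inr ⟨_, .tyList⟩
    | record => exact .inr ⟨_, .tyRecord⟩
    | trace => exact .inr ⟨_, .tyTrace⟩
    | lam => exact (HasKind.not_lam_type hC).elim
  | litBool _ ih | litInt _ ih | litStr _ ih =>
    rcases ih with h | ⟨_, h⟩
    exacts [.inl (.trLit h), .inr ⟨_, .trLit h⟩]
  | trIf _ ih =>
    rcases ih with h | ⟨_, h⟩
    exacts [.inl (.trIf h), .inr ⟨_, .trIf h⟩]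
  | trFor hC _ ih =>
    rcases hC.progress with h₀ | ⟨_, h⟩
    swap; · exact .inr ⟨_, .trFor₁ h⟩
    rcases ih with h | ⟨_, h⟩
    exacts [.inl (.trFor h₀ h), .inr ⟨_, .trFor₂ h⟩]
  | trCell _ ih =>
    rcases ih with h | ⟨_, h⟩
    exacts [.inl (.trCell h), .inr ⟨_, .trCell h⟩]
  | trOpEq hC _ ih =>
    rcases hC.progress with h₀ | ⟨_, h⟩
    swap; · exact .inr ⟨_, .trOpEq₁ h⟩
    rcases ih with h | ⟨_, h⟩
    exacts [.inl (.trOpEq h₀ h), .inr ⟨_, .trOpEq₂ h⟩]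
  | trOpPlus _ ih =>
    rcases ih with h | ⟨_, h⟩
    exacts [.inl (.trOpPlus h), .inr ⟨_, .trOpPlus h⟩]
  | tracecase hM _ _ _ _ _ _ ih₀ ih₁ ih₂ ih₃ ih₄ ih₅ ih₆ =>
    rcases ih₀ with h₀ | ⟨_, h⟩
    swap; · exact .inr ⟨_, .tcScrut h⟩
    rcases ih₁ with h₁ | ⟨_, h⟩
    swap; · exact .inr ⟨_, .tcL h⟩
    rcases ih₂ with h₂ | ⟨_, h⟩
    swap; · exact .inr ⟨_, .tcI h⟩
    rcases ih₃ with h₃ | ⟨_, h⟩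
    swap; · exact .inr ⟨_, .tcF h⟩
    rcases ih₄ with h₄ | ⟨_, h⟩
    swap; · exact .inr ⟨_, .tcC h⟩
    rcases ih₅ with h₅ | ⟨_, h⟩
    swap; · exact .inr ⟨_, .tcE h⟩
    rcases ih₆ with h₆ | ⟨_, h⟩
    swap; · exact .inr ⟨_, .tcP h⟩
    cases h₀ with
    | neutral h => exact .inl (.neutral (.tracecase h h₁ h₂ h₃ h₄ h₅ h₆))
    | ite => exact .inr ⟨_, .ccTracecase⟩
    | trLit => exact .inr ⟨_, .tcLit⟩
    | trIf => exact .inr ⟨_, .tcIf⟩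
    | trFor => exact .inr ⟨_, .tcFor⟩
    | trCell => exact .inr ⟨_, .tcCell⟩
    | trOpEq => exact .inr ⟨_, .tcOpEq⟩
    | trOpPlus => exact .inr ⟨_, .tcOpPlus⟩
    | @const c => cases c <;> cases hM.shape_eq rfl rfl
    | _ => cases hM.shape_eq rfl rfl
  -- The remaining typing rule is the one for comprehensions.
  | _ =>
    rename_i hM _ ih₁ ih₂
    rcases ih₁ with h₁ | ⟨_, h⟩
    swap; · exact .inr ⟨_, .for₁ h⟩
    rcases ih₂ with h₂ | ⟨_, h⟩
    swap; · exact .inr ⟨_, .for₂ h⟩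
    cases h₁ with
    | neutral h => exact .inl (.for (.neutral h) h₂)
    | table => exact .inl (.for .table h₂)
    | nil => exact .inr ⟨_, .forNil⟩
    | single => exact .inr ⟨_, .forSingle⟩
    | append => exact .inr ⟨_, .ccForAppend⟩
    | ite => exact .inr ⟨_, .ccForIte⟩
    | @const c => cases c <;> cases hM.shape_eq rfl rfl
    -- A nested comprehension is reassociated; every other remaining form does not have the shape of
    -- a list.
    | _ => first | exact .inr ⟨_, .ccForFor⟩ | cases hM.shape_eq rfl rfl

end LinksT

theorem mainTheorem3 (Δ : List LinksT.Kind) (Γ : List (LinksT.Ty .con)) (M : LinksT.Tm)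
    (A : LinksT.Ty .con) (hM : LinksT.HasType Δ Γ M A) :
    LinksT.Normal M ∨ ∃ M' : LinksT.Tm, LinksT.Tm.Red M M' :=
  hM.progress
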